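/- **Definitions.** Let $\mathcal N=\omega^\omega$ be the Baire space. A *family of pointclasses* assigns to each topological space $X$ a collection $\mathbf\Gamma(X)$ of subsets of $X$. Write $\mathbf\Gamma_c,\mathbf\Gamma_d,\mathbf\Gamma_\sigma,\mathbf\Gamma_\delta$ for the families of complements, differences, countable unions and countable intersections of sets in $\mathbf\Gamma(X)$, and $\mathbf\Gamma_\exists(X)$ for the collection of projections $\{x\in X\mid\exists p\in\mathcal N.\,(p,x)\in A\}$ with $A\in\mathbf\Gamma(\mathcal N\times X)$. The hyperprojective hierarchy is defined for $\alpha<\omega_1$ by $\mathbf\Sigma^1_0=\mathbf\Sigma^0_2=\mathcal O_{d\sigma}$ (where $\mathcal O(X)$ is the topology of $X$), $\mathbf\Sigma^1_{\alpha+1}=(\mathbf\Sigma^1_\alpha)_{c\exists}$, and $\mathbf\Sigma^1_\lambda=\bigl(\bigcup_{\alpha<\lambda}\mathbf\Sigma^1_\alpha\bigr)_{\delta\exists}$ for limit $\lambda$. A *qcb$_0$-space* is a $T_0$-space that is a topological quotient of a countably based space; $\mathsf{QCB_0}$ is the category of qcb$_0$-spaces and continuous functions. An *admissible representation* of a space $X$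 is a continuous surjection $\delta\colon D\to X$ from a subspace $D\subseteq\mathcal N$ such that every continuous $\nu\colon Z\to X$ with $Z\subseteq\mathcal N$ factors as $\nu=\delta g$ for some continuous $g\colon Z\to D$. Put $EQ(\delta)=\{(p,q)\in D^2\mid\delta(p)=\delta(q)\}$. A qcb$_0$-space is *hyperprojective* if, for some $\alpha<\omega_1$, it has an admissible representation $\delta$ with $EQ(\delta)\in\mathbf\Sigma^1_\alpha(\mathcal N^2)$. Let $\mathsf{QCB_0}(\mathbf{HP})$ be the full subcategory of $\mathsf{QCB_0}$ whose objects are the hyperprojective qcb$_0$-spaces. **Theorem 7.1.** Both $\mathsf{QCB_0}$ and $\mathsf{QCB_0}(\mathbf{HP})$ are cartesian closed, countably complete and countably co-complete. Moreover $\mathsf{QCB_0}(\mathbf{HP})$ inherits its exponentials, countable products, countable co-products, equalizers and co-equalizers from $\mathsf{QCB_0}$: each of these constructions, performed in $\mathsf{QCB_0}$ on hyperprojective spaces (and continuous functions between them), yields a hyperprojective space, and the inclusion functor $\mathsf{QCB_0}(\mathbf{HP})\to\mathsf{QCB_0}$ preserves exponentials, countable products, countable co-products, equalizers and co-equalizers.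 -/

import Mathlib

open CategoryTheory CategoryTheory.Limits

universe u

namespace Hyperprojective

/-! ### Families of pointclasses and the operations on them -/

/-- The Baire space, with the product of the discrete topologies. -/
abbrev Baire : Type := ℕ → ℕ

/-- A family of pointclasses: it assigns to every topological space a collection of subsets. -/
abbrev PointclassFamily : Type (u + 1) :=
  (X : Type u) → [TopologicalSpace X] → Set (Set X)

namespace PointclassFamily

/-- The family of the topologies of all spaces. -/
def opens : PointclassFamily.{u} := fun X _ ↦ {A | IsOpen A}

theorem mem_opens {X : Type u} [TopologicalSpace X] {A : Set X} : A ∈ opens X ↔ IsOpen A :=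
  Iff.rfl

/-- `Γ_c`: complements of sets in `Γ`. -/
def compls (Γ : PointclassFamily.{u}) : PointclassFamily.{u} :=
  fun X _ ↦ {A | ∃ B ∈ Γ X, A = Bᶜ}

/-- `Γ_d`: differences of sets in `Γ`. -/
def diffs (Γ : PointclassFamily.{u}) : PointclassFamily.{u} :=
  fun X _ ↦ {A | ∃ B ∈ Γ X, ∃ C ∈ Γ X, A = B \ C}

/-- `Γ_σ`: countable unions of sets in `Γ`. -/
def countableUnions (Γ : PointclassFamily.{u}) : PointclassFamily.{u} :=
  fun X _ ↦ {A | ∃ B : ℕ → Set X, (∀ n, B n ∈ Γ X) ∧ A = ⋃ n, B n}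

/-- `Γ_δ`: countable intersections of sets in `Γ`. -/
def countableInters (Γ : PointclassFamily.{u}) : PointclassFamily.{u} :=
  fun X _ ↦ {A | ∃ B : ℕ → Set X, (∀ n, B n ∈ Γ X) ∧ A = ⋂ n, B n}

/-- `Γ_∃`: projections along the Baire space of sets in `Γ (Baire × X)`. -/
def projections (Γ : PointclassFamily.{u}) : PointclassFamily.{u} :=
  fun X _ ↦ {A | ∃ B ∈ Γ (Baire × X), A = {x | ∃ p : Baire, (p, x) ∈ B}}

end PointclassFamily

open PointclassFamily

/-- The family `𝚺⁰₂`: countable unions of differences of open sets. -/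
def sigma02 : PointclassFamily.{u} := opens.diffs.countableUnions

/-- The families `𝚺¹_α` of the hyperprojective hierarchy, by transfinite recursion on `α`:
`𝚺¹_0 = 𝚺⁰₂`, `𝚺¹_{α+1} = (𝚺¹_α)_{c∃}`, and `𝚺¹_l = (⋃_{α<l} 𝚺¹_α)_{δ∃}` for limit `l`.
(Only the values at countable `α` are used.) -/
noncomputable def sigma1 (α : Ordinal.{0}) : PointclassFamily.{u} :=
  Ordinal.limitRecOn α
    sigma02
    (fun _ Γ ↦ Γ.compls.projections)
    (fun l _ Γ ↦ PointclassFamily.projections (PointclassFamily.countableInters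
      (fun X _ ↦ {A | ∃ (β : Ordinal.{0}) (h : β < l), A ∈ Γ β h X})))

theorem sigma1_zero : sigma1.{u} 0 = sigma02 := by
  simp [sigma1]

theorem sigma1_succ (α : Ordinal.{0}) :
    sigma1.{u} (Order.succ α) = (sigma1 α).compls.projections := by
  simp [sigma1]

theorem sigma1_limit (l : Ordinal.{0}) (hl : Order.IsSuccLimit l) :
    sigma1.{u} l = PointclassFamily.projections (PointclassFamily.countableInters
      (fun X _ ↦ {A | ∃ β < l, A ∈ sigma1 β X})) := by
  rw [sigma1, Ordinal.limitRecOn_limit _ _ _ _ hl]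
  simp only [sigma1, exists_prop]

/-! ### qcb₀-spaces and admissible representations -/

/-- A qcb₀-space: a `T₀`-space that is a topological quotient of a countably based space. -/
def IsQCB0 (X : Type u) [TopologicalSpace X] : Prop :=
  T0Space X ∧ ∃ (A : Type u) (_ : TopologicalSpace A) (q : A → X),
    SecondCountableTopology A ∧ Topology.IsQuotientMap q

section Representations

variable {X : Type u} [TopologicalSpace X]

/-- A partial surjection `δ` from the Baire space onto `X`, with domain `D`, is an admissible
representation of `X` if it is continuous and every continuous function `ν` from a subspace of the
Baire space to `X` factors continuously through `δ`. -/
structure IsAdmissible {D : Set Baire} (δ : D → X) : Prop where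
  surjective : Function.Surjective δ
  continuous : Continuous δ
  factors : ∀ (Z : Set Baire) (ν : Z → X), Continuous ν →
    ∃ g : Z → D, Continuous g ∧ ν = δ ∘ g

/-- `EQ(δ)`: the set of pairs of names in the domain `D` of `δ` that name the same point. -/
def EQ {D : Set Baire} (δ : D → X) : Set (Baire × Baire) :=
  {r | ∃ (h₁ : r.1 ∈ D) (h₂ : r.2 ∈ D), δ ⟨r.1, h₁⟩ = δ ⟨r.2, h₂⟩}

end Representations

/-- `X` is `Γ`-representable: it has an admissible representation `δ` with `EQ(δ)` in
`Γ (Baire × Baire)`. -/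
def IsRepresentable (Γ : PointclassFamily.{0}) (X : Type u) [TopologicalSpace X] : Prop :=
  ∃ (D : Set Baire) (δ : D → X), IsAdmissible δ ∧ EQ δ ∈ Γ (Baire × Baire)

/-! ### The categories -/

/-- The category of qcb₀-spaces and continuous functions. -/
abbrev QCB0 : Type (u + 1) :=
  ObjectProperty.FullSubcategory (fun X : TopCat.{u} ↦ IsQCB0 X)

/-- The hyperprojective qcb₀-spaces: those that are `𝚺¹_α`-representable for some countable
ordinal `α`. -/
def hyperprojective : ObjectProperty QCB0.{u} :=
  fun X ↦ ∃ α : Ordinal.{0}, α < Ordinal.omega 1 ∧ IsRepresentable (sigma1 α) X.obj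

/-- The full subcategory of `QCB0` on the hyperprojective qcb₀-spaces. -/
abbrev QCB0HP : Type (u + 1) := (hyperprojective.{u}).FullSubcategory

/-- The inclusion functor of the hyperprojective qcb₀-spaces into the qcb₀-spaces. -/
abbrev incl : QCB0HP.{u} ⥤ QCB0.{u} := (hyperprojective.{u}).ι

end Hyperprojective

open Hyperprojective

universe v w

namespace Hyperprojective

open Topology Filter Set

/-! ### Projectively closed families of pointclasses -/

/-- A family of pointclasses that contains the open sets and is closed under complements, countable
intersections, projections along the Baire space and continuous preimages. -/
class ProjectivelyClosed (Γ : PointclassFamily.{0}) : Prop where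
  isOpen_mem {X : Type} [TopologicalSpace X] {A : Set X} : IsOpen A → A ∈ Γ X
  compl_mem {X : Type} [TopologicalSpace X] {A : Set X} : A ∈ Γ X → Aᶜ ∈ Γ X
  iInter_mem {X : Type} [TopologicalSpace X] {A : ℕ → Set X} : (∀ n, A n ∈ Γ X) → ⋂ n, A n ∈ Γ X
  projection_mem {X : Type} [TopologicalSpace X] {A : Set (Baire × X)} :
    A ∈ Γ (Baire × X) → {x | ∃ p, (p, x) ∈ A} ∈ Γ X
  preimage_mem {X Y : Type} [TopologicalSpace X] [TopologicalSpace Y] {f : X → Y} {A : Set Y} :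
    Continuous f → A ∈ Γ Y → f ⁻¹' A ∈ Γ X

/-- The family of all subsets. -/
def allSets : PointclassFamily.{0} := fun _ _ ↦ univ

instance : ProjectivelyClosed allSets where
  isOpen_mem _ := mem_univ _
  compl_mem _ := mem_univ _
  iInter_mem _ := mem_univ _
  projection_mem _ := mem_univ _
  preimage_mem _ _ := mem_univ _

/-- The family of the hyperprojective sets. -/
def hyperprojectiveSets : PointclassFamily.{0} :=
  fun X _ ↦ {A | ∃ α : Ordinal.{0}, α < Ordinal.omega 1 ∧ A ∈ sigma1 α X}

theorem sigma1_preimage (α : Ordinal.{0}) : ∀ {X Y : Type} [TopologicalSpace X]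
    [TopologicalSpace Y] {f : X → Y} {A : Set Y}, Continuous f → A ∈ sigma1 α Y →
      f ⁻¹' A ∈ sigma1 α X := by
  induction α using Ordinal.limitRecOn with
  | zero =>
    intro X Y _ _ f A hf hA
    rw [sigma1_zero] at hA ⊢
    obtain ⟨B, hB, rfl⟩ := hA
    refine ⟨fun n ↦ f ⁻¹' B n, fun n ↦ ?_, preimage_iUnion⟩
    obtain ⟨U, hU, V, hV, hUV⟩ := hB n
    exact ⟨f ⁻¹' U, hf.isOpen_preimage _ hU, f ⁻¹' V, hf.isOpen_preimage _ hV, by simp [hUV]⟩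
  | add_one α ih =>
    intro X Y _ _ f A hf hA
    rw [← Order.succ_eq_add_one, sigma1_succ] at hA ⊢
    obtain ⟨_, ⟨B, hB, rfl⟩, rfl⟩ := hA
    exact ⟨_, ⟨Prod.map id f ⁻¹' B, ih (continuous_id.prodMap hf) hB, rfl⟩, rfl⟩
  | limit l hl ih =>
    intro X Y _ _ f A hf hA
    rw [sigma1_limit l hl] at hA ⊢
    obtain ⟨_, ⟨B, hB, rfl⟩, rfl⟩ := hA
    refine ⟨⋂ n, Prod.map id f ⁻¹' B n, ⟨_, fun n ↦ ?_, rfl⟩, ?_⟩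
    · obtain ⟨β, hβ, h⟩ := hB n
      exact ⟨β, hβ, ih β hβ (continuous_id.prodMap hf) h⟩
    · ext x; simp

/-- The successor step forces a projection, so `A` is first pulled back to a cylinder over the Baire
space; projecting its complement changes nothing because the Baire space is nonempty. -/
theorem sigma1_succ_of_compl {α : Ordinal.{0}} {X : Type} [TopologicalSpace X] {A : Set X}
    (hA : A ∈ sigma1 α X) : Aᶜ ∈ sigma1 (Order.succ α) X := by
  rw [sigma1_succ]
  refine ⟨_, ⟨Prod.snd ⁻¹' A, sigma1_preimage α continuous_snd hA, rfl⟩, ?_⟩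
  ext x; simp

theorem succ_lt_omega_one {α : Ordinal.{0}} (h : α < Ordinal.omega 1) :
    Order.succ α < Ordinal.omega 1 := by
  rw [← Cardinal.ord_aleph] at h ⊢
  exact (Cardinal.isSuccLimit_ord (Cardinal.aleph0_le_aleph 1)).succ_lt h

theorem exists_isSuccLimit_lt_omega_one (a : ℕ → Ordinal.{0}) (ha : ∀ n, a n < Ordinal.omega 1) :
    ∃ l : Ordinal.{0}, Order.IsSuccLimit l ∧ l < Ordinal.omega 1 ∧ ∀ n, a n < l := by
  -- Adding `ω` makes the bound a limit strictly above every `a n`; it stays below `ω₁` because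
  -- countable suprema of countable ordinals are countable.
  refine ⟨(⨆ n, a n) + Ordinal.omega0, Ordinal.isSuccLimit_add _ Ordinal.isSuccLimit_omega0, ?_,
    fun n ↦ (Ordinal.le_iSup a n).trans_lt (lt_add_of_pos_right _ Ordinal.omega0_pos)⟩
  have key : ∀ k : ℕ, (⨆ n, a n) + k < Ordinal.omega 1 := by
    intro k
    induction k with
    | zero => simpa using Ordinal.iSup_lt_omega_one ha
    | succ k ih =>
      rw [Nat.cast_succ, ← add_assoc, ← Order.succ_eq_add_one]
      exact succ_lt_omega_one ih
  refine lt_of_le_of_lt ((Ordinal.add_le_iff_of_isSuccLimit Ordinal.isSuccLimit_omega0).2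
    fun b hb ↦ ?_) (Ordinal.iSup_lt_omega_one key)
  obtain ⟨k, rfl⟩ := Ordinal.lt_omega0.1 hb
  exact Ordinal.le_iSup (fun k : ℕ ↦ (⨆ n, a n) + (k : Ordinal)) k

instance : ProjectivelyClosed hyperprojectiveSets where
  isOpen_mem {X _ A} hA := by
    refine ⟨0, Ordinal.omega_pos 1, ?_⟩
    rw [sigma1_zero]
    exact ⟨fun _ ↦ A, fun _ ↦ ⟨A, hA, ∅, isOpen_empty, sdiff_empty.symm⟩, (iUnion_const A).symm⟩
  compl_mem {X _ A} hA := by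
    obtain ⟨α, hα, h⟩ := hA
    exact ⟨_, succ_lt_omega_one hα, sigma1_succ_of_compl h⟩
  iInter_mem {X _ A} hA := by
    choose a ha h using hA
    -- Limit levels absorb countable intersections of sets from lower levels, so a common limit
    -- bound suffices; the closing projection runs over a dummy coordinate.
    obtain ⟨l, hl, hlt, hal⟩ := exists_isSuccLimit_lt_omega_one a ha
    refine ⟨l, hlt, ?_⟩
    rw [sigma1_limit l hl]
    refine ⟨⋂ n, Prod.snd ⁻¹' A n,
      ⟨_, fun n ↦ ⟨a n, hal n, sigma1_preimage _ continuous_snd (h n)⟩, rfl⟩, ?_⟩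
    ext x; simp
  projection_mem {X _ A} hA := by
    obtain ⟨α, hα, h⟩ := hA
    -- Two levels up: the successor step complements before projecting, so it is applied to the
    -- complement of `A`.
    refine ⟨_, succ_lt_omega_one (succ_lt_omega_one hα), ?_⟩
    rw [sigma1_succ]
    exact ⟨_, ⟨_, sigma1_succ_of_compl h, rfl⟩, by simp⟩
  preimage_mem hf hA := by
    obtain ⟨α, hα, h⟩ := hA
    exact ⟨α, hα, sigma1_preimage α hf h⟩

theorem hyperprojective_iff {X : QCB0.{u}} :
    hyperprojective X ↔ IsRepresentable hyperprojectiveSets X.obj :=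
  ⟨fun ⟨α, hα, D, δ, hδ, h⟩ ↦ ⟨D, δ, hδ, α, hα, h⟩,
    fun ⟨D, δ, hδ, α, hα, h⟩ ↦ ⟨α, hα, D, δ, hδ, h⟩⟩

namespace ProjectivelyClosed

variable {Γ : PointclassFamily.{0}} [ProjectivelyClosed Γ] {X Y : Type} [TopologicalSpace X]
  [TopologicalSpace Y] {A B : Set X}

theorem isClosed_mem (hA : IsClosed A) : A ∈ Γ X := by
  rw [← compl_compl A]; exact compl_mem (isOpen_mem hA.isOpen_compl)

theorem iInter_countable_mem {ι : Sort*} [Countable ι] {A : ι → Set X} (h : ∀ i, A i ∈ Γ X) :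
    ⋂ i, A i ∈ Γ X := by
  cases isEmpty_or_nonempty ι
  · rw [iInter_of_empty]; exact isOpen_mem isOpen_univ
  · obtain ⟨f, hf⟩ := exists_surjective_nat ι
    rw [← hf.iInter_comp]
    exact iInter_mem fun n ↦ h _

theorem iUnion_countable_mem {ι : Sort*} [Countable ι] {A : ι → Set X} (h : ∀ i, A i ∈ Γ X) :
    ⋃ i, A i ∈ Γ X := by
  rw [← compl_compl (⋃ i, A i), compl_iUnion]
  exact compl_mem (iInter_countable_mem fun i ↦ compl_mem (h i))

theorem inter_mem (hA : A ∈ Γ X) (hB : B ∈ Γ X) : A ∩ B ∈ Γ X := by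
  rw [inter_eq_iInter]; exact iInter_countable_mem (by rintro (_ | _) <;> assumption)

/-- Preimages under continuous functions that are defined on a set in the pointclass. -/
theorem partial_preimage_mem {Z : Set X} (hZ : Z ∈ Γ X) {g : Z → Baire} (hg : Continuous g)
    {A : Set Baire} (hA : A ∈ Γ Baire) : {x | ∃ h : x ∈ Z, g ⟨x, h⟩ ∈ A} ∈ Γ X := by
  -- Since the Baire space is Hausdorff, the graph of `g` is closed in `Baire × Z`, hence is the
  -- trace there of its closure in `Baire × X`. The preimage is thus the projection of a closed set
  -- intersected with `Z` and `A`.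
  set G : Set (Baire × X) := range fun z : Z ↦ (g z, z.1)
  have hG : IsClosed[instTopologicalSpaceProd] (closure G) := isClosed_closure
  have key : ∀ p x, ∀ h : x ∈ Z, (p, x) ∈ closure G → p = g ⟨x, h⟩ := by
    intro p x h hp
    have hcl : IsClosed {r : Baire × Z | r.1 = g r.2} :=
      isClosed_eq continuous_fst (hg.comp continuous_snd)
    have hemb : IsEmbedding (Prod.map (id : Baire → Baire) (Subtype.val : Z → X)) :=
      IsEmbedding.id.prodMap .subtypeVal
    have : (p, (⟨x, h⟩ : Z)) ∈ closure {r : Baire × Z | r.1 = g r.2} := by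
      rw [hemb.closure_eq_preimage_closure_image]
      refine closure_mono ?_ hp
      rintro _ ⟨z, rfl⟩
      exact ⟨(g z, z), rfl, rfl⟩
    rwa [hcl.closure_eq] at this
  convert projection_mem (inter_mem (inter_mem (isClosed_mem hG)
    (preimage_mem (Γ := Γ) continuous_snd hZ)) (preimage_mem (Γ := Γ) continuous_fst hA)) using 1
  ext x
  constructor
  · rintro ⟨h, hx⟩
    exact ⟨g ⟨x, h⟩, ⟨subset_closure ⟨⟨x, h⟩, rfl⟩, h⟩, hx⟩
  · rintro ⟨p, ⟨hp, h⟩, hA⟩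
    refine ⟨h, ?_⟩
    rw [← key p x h hp]
    exact hA

end ProjectivelyClosed

/-! ### Retracts of the Baire space -/

/-- The space `T` is a retract of the Baire space. -/
def IsBaireRetract (T : Type) [TopologicalSpace T] : Prop :=
  ∃ (e : Baire → T) (s : T → Baire), Continuous e ∧ Continuous s ∧ ∀ t, e (s t) = t

theorem isBaireRetract_baire : IsBaireRetract Baire :=
  ⟨id, id, continuous_id, continuous_id, fun _ ↦ rfl⟩

theorem isBaireRetract_countable_pi (J : Type) [Countable J] : IsBaireRetract (J → ℕ) := by
  obtain ⟨_⟩ := nonempty_encodable J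
  refine ⟨fun p j ↦ p (Encodable.encode j), fun r k ↦ (Encodable.decode k).elim 0 r,
    by fun_prop, ?_, fun t ↦ by simp⟩
  refine continuous_pi fun k ↦ ?_
  cases (Encodable.decode k : Option J) with
  | none => exact continuous_const
  | some j => exact continuous_apply j

theorem IsBaireRetract.of_retract {T T' : Type} [TopologicalSpace T] [TopologicalSpace T']
    (h : IsBaireRetract T) (e : T → T') (s : T' → T) (he : Continuous e) (hs : Continuous s)
    (hes : ∀ t, e (s t) = t) : IsBaireRetract T' := by
  obtain ⟨e', s', he', hs', h'⟩ := h
  exact ⟨e ∘ e', s' ∘ s, he.comp he', hs'.comp hs, fun t ↦ by simp [h', hes]⟩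

theorem isBaireRetract_baire_prod : IsBaireRetract (Baire × Baire) := by
  refine (isBaireRetract_countable_pi (ℕ ⊕ ℕ)).of_retract
    (fun r ↦ (fun n ↦ r (.inl n), fun n ↦ r (.inr n))) (fun r ↦ Sum.elim r.1 r.2)
    (by fun_prop) (continuous_pi ?_) fun _ ↦ rfl
  rintro (n | n) <;> simp <;> fun_prop

theorem IsBaireRetract.prod {T T' : Type} [TopologicalSpace T] [TopologicalSpace T']
    (h : IsBaireRetract T) (h' : IsBaireRetract T') : IsBaireRetract (T × T') := by
  obtain ⟨e, s, he, hs, hes⟩ := h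
  obtain ⟨e', s', he', hs', hes'⟩ := h'
  exact isBaireRetract_baire_prod.of_retract (Prod.map e e') (Prod.map s s') (he.prodMap he')
    (hs.prodMap hs') fun t ↦ Prod.ext (hes _) (hes' _)

theorem IsBaireRetract.exists_isEmbedding {T : Type} [TopologicalSpace T] (h : IsBaireRetract T) :
    ∃ s : T → Baire, IsEmbedding s := by
  obtain ⟨e, s, he, hs, hes⟩ := h
  exact ⟨s, .of_leftInverse hes he hs⟩

theorem isBaireRetract_pi (J : Type) [Countable J] : IsBaireRetract (J → Baire) :=
  (isBaireRetract_countable_pi (J × ℕ)).of_retract (fun r j n ↦ r (j, n)) (fun r jn ↦ r jn.1 jn.2)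
    (by fun_prop) (by fun_prop) fun _ ↦ rfl

theorem isBaireRetract_nat_prod : IsBaireRetract (ℕ × Baire) :=
  isBaireRetract_baire.of_retract (fun p ↦ (p 0, fun n ↦ p (n + 1)))
    (fun r n ↦ Nat.casesOn n r.1 r.2)
    (by fun_prop)
    (continuous_pi (by rintro (_ | n) <;> simp <;> fun_prop)) fun ⟨_, _⟩ ↦ rfl

theorem ProjectivelyClosed.partial_preimage_mem_of_retract {Γ : PointclassFamily.{0}}
    [ProjectivelyClosed Γ] {X T : Type} [TopologicalSpace X] [TopologicalSpace T]
    (hT : IsBaireRetract T) {Z : Set X} (hZ : Z ∈ Γ X) {g : Z → T} (hg : Continuous g)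
    {A : Set T} (hA : A ∈ Γ T) : {x | ∃ h : x ∈ Z, g ⟨x, h⟩ ∈ A} ∈ Γ X := by
  obtain ⟨e, s, he, hs, h⟩ := hT
  convert partial_preimage_mem hZ (hs.comp hg) (preimage_mem (Γ := Γ) he hA) using 1
  ext x
  simp [h]

theorem ProjectivelyClosed.exists_mem_of_retract {Γ : PointclassFamily.{0}}
    [ProjectivelyClosed Γ] {X T : Type} [TopologicalSpace X] [TopologicalSpace T]
    (hT : IsBaireRetract T) {A : Set (T × X)} (hA : A ∈ Γ (T × X)) :
    {x | ∃ t, (t, x) ∈ A} ∈ Γ X := by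
  obtain ⟨e, s, he, hs, h⟩ := hT
  convert projection_mem (preimage_mem (Γ := Γ) (he.prodMap continuous_id) hA) using 1
  ext x
  exact ⟨fun ⟨t, ht⟩ ↦ ⟨s t, by simpa [h] using ht⟩, fun ⟨p, hp⟩ ↦ ⟨e p, hp⟩⟩

/-! ### Spaces generated by convergent sequences -/

/-- The one-member family that consists of the generic convergent sequence. -/
abbrev ConvSeq : Unit → Type := fun _ ↦ OnePoint ℕ

/-- The indicator functions of the points, which embed the generic convergent sequence in the Baire
space. -/
noncomputable def convSeqToBaire : OnePoint ℕ → Baire := fun n k ↦ by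
  classical exact if n = (k : OnePoint ℕ) then 1 else 0

theorem continuous_convSeqToBaire : Continuous convSeqToBaire := by
  rw [OnePoint.continuous_iff_from_nat, tendsto_pi_nhds]
  intro k
  refine tendsto_const_nhds.congr' ?_
  filter_upwards [eventually_gt_atTop k] with n hn
  simp [convSeqToBaire, hn.ne']

/-- A continuous injection of a compact space into a Hausdorff space; the point at infinity goes to
the zero sequence. It lets convergent sequences be lifted through admissible representations. -/
theorem isEmbedding_convSeqToBaire : IsEmbedding convSeqToBaire := by
  refine (continuous_convSeqToBaire.isClosedEmbedding ?_).isEmbedding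
  intro a b hab
  induction a using OnePoint.rec with
  | infty =>
    induction b using OnePoint.rec with
    | infty => rfl
    | coe m => simpa [convSeqToBaire] using congrFun hab m
  | coe n => simpa [convSeqToBaire, eq_comm] using congrFun hab n

instance : SecondCountableTopology (OnePoint ℕ) :=
  isEmbedding_convSeqToBaire.secondCountableTopology

instance (priority := 50) isGeneratedBy_convSeq {X : Type u} [TopologicalSpace X]
    [SequentialSpace X] : IsGeneratedBy ConvSeq X where
  continuous_equiv_symm := by
    rw [continuous_iff_isClosed]
    intro C hC
    rw [WithGeneratedByTopology.isClosed_iff] at hC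
    refine IsSeqClosed.isClosed fun x a hx hxa ↦ ?_
    let f : OnePoint ℕ → X := fun n ↦ n.elim a x
    have hf : Continuous f := by
      rw [OnePoint.continuous_iff_from_nat]
      exact hxa
    have h := hC (i := ()) ⟨f, hf⟩
    have hlim : Tendsto (fun n : ℕ ↦ (n : OnePoint ℕ)) atTop (𝓝 OnePoint.infty) :=
      (OnePoint.continuous_iff_from_nat id).1 continuous_id
    exact h.mem_of_tendsto hlim (Eventually.of_forall hx)

theorem EQ_comp_injective {X : Type u} {Y : Type v} {D : Set Baire} (δ : D → X) {e : X → Y}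
    (he : Function.Injective e) :
    EQ (e ∘ δ) = EQ δ := by
  ext r; simp [EQ, he.eq_iff]

open ProjectivelyClosed

section

variable {X : Type u} {Y : Type v} {W : Type w} [TopologicalSpace X] [TopologicalSpace Y]
  [TopologicalSpace W]

/-- Sequential continuity, as continuity on all convergent sequences. -/
abbrev SCont (f : X → Y) : Prop := ContinuousGeneratedBy ConvSeq f

theorem _root_.Topology.ContinuousGeneratedBy.continuous [IsGeneratedBy ConvSeq X] {f : X → Y}
    (hf : SCont f) : Continuous f :=
  (IsGeneratedBy.continuous_iff ConvSeq f).2 hf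

theorem _root_.Topology.ContinuousGeneratedBy.prodMk {f : X → Y} {g : X → W} (hf : SCont f)
    (hg : SCont g) : SCont fun x ↦ (f x, g x) :=
  fun _ φ ↦ (hf φ).prodMk (hg φ)

/-- The sequential coreflection of a space. -/
abbrev Seq (X : Type u) [TopologicalSpace X] : Type u := WithGeneratedByTopology ConvSeq X

/-- The sequentially continuous functions, with the topology of continuous convergence. -/
abbrev SMap (X : Type u) (Y : Type v) [TopologicalSpace X] [TopologicalSpace Y] : Type _ :=
  ContinuousMapGeneratedBy ConvSeq X Y

theorem scont_toSeq : SCont (WithGeneratedByTopology.equiv.symm : X → Seq X) :=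
  (WithGeneratedByTopology.equivSymmAsContinuousMapGeneratedBy ConvSeq X).prop

theorem continuous_fromSeq : Continuous (WithGeneratedByTopology.equiv : Seq X → X) :=
  WithGeneratedByTopology.continuous_equiv

/-! ### Admissible representations -/

namespace IsAdmissible

variable {D : Set Baire} {δ : D → X}

/-- Transports the factorization property to any space that embeds in the Baire space, notably to
`OnePoint ℕ` and to products of subspaces. -/
theorem exists_lift (hδ : IsAdmissible δ) {e : Y → Baire} (he : IsEmbedding e) {ν : Y → X}
    (hν : Continuous ν) : ∃ g : Y → D, Continuous g ∧ ∀ y, δ (g y) = ν y := by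
  obtain ⟨g, hg, h⟩ := hδ.factors (range e) (ν ∘ he.toHomeomorph.symm)
    (hν.comp he.toHomeomorph.symm.continuous)
  refine ⟨g ∘ he.toHomeomorph, hg.comp he.toHomeomorph.continuous, fun y ↦ ?_⟩
  simpa using (congrFun h (he.toHomeomorph y)).symm

/-- Convergent sequences lift to names, and closed sets of a sequential space are detected on
convergent sequences. -/
theorem isQuotientMap [IsGeneratedBy ConvSeq X] (hδ : IsAdmissible δ) : IsQuotientMap δ := by
  refine isQuotientMap_iff_isClosed.2 ⟨hδ.surjective, fun U ↦
    ⟨fun h ↦ h.preimage hδ.continuous, fun h ↦ ?_⟩⟩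
  rw [IsGeneratedBy.isClosed_iff ConvSeq]
  intro _ f
  obtain ⟨g, hg, hgf⟩ := hδ.exists_lift isEmbedding_convSeqToBaire f.continuous
  convert h.preimage hg using 1
  ext y
  simp [hgf]

/-- Subspaces of the Baire space are sequential, so they have the same continuous functions into a
space and into its sequential coreflection. -/
theorem toSeq (hδ : IsAdmissible δ) :
    IsAdmissible ((WithGeneratedByTopology.equiv.symm : X → Seq X) ∘ δ) where
  surjective := WithGeneratedByTopology.equiv.symm.surjective.comp hδ.surjective
  continuous := (scont_toSeq.comp hδ.continuous.continuousGeneratedBy).continuous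
  factors Z ν hν := by
    obtain ⟨g, hg, h⟩ := hδ.factors Z (WithGeneratedByTopology.equiv ∘ ν)
      (continuous_fromSeq.comp hν)
    exact ⟨g, hg, by rw [Function.comp_assoc, ← h]; rfl⟩

theorem comp_homeomorph (hδ : IsAdmissible δ) (e : X ≃ₜ Y) : IsAdmissible (e ∘ δ) where
  surjective := e.surjective.comp hδ.surjective
  continuous := e.continuous.comp hδ.continuous
  factors Z ν hν := by
    obtain ⟨g, hg, h⟩ := hδ.factors Z (e.symm ∘ ν) (e.symm.continuous.comp hν)
    refine ⟨g, hg, ?_⟩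
    rw [Function.comp_assoc, ← h]
    ext z
    simp

end IsAdmissible

variable {Γ : PointclassFamily.{0}}

theorem IsRepresentable.of_homeomorph (h : IsRepresentable Γ X) (e : X ≃ₜ Y) :
    IsRepresentable Γ Y := by
  obtain ⟨D, δ, hδ, hE⟩ := h
  exact ⟨D, _, hδ.comp_homeomorph e, by rwa [EQ_comp_injective δ e.injective]⟩

theorem IsRepresentable.toSeq (h : IsRepresentable Γ X) : IsRepresentable Γ (Seq X) := by
  obtain ⟨D, δ, hδ, hE⟩ := h
  exact ⟨D, _, hδ.toSeq, by rwa [EQ_comp_injective δ (Equiv.injective _)]⟩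

/-- A set is definable if its preimage under every continuous function from a set in the pointclass
is in the pointclass. -/
def Definable (Γ : PointclassFamily.{0}) (A : Set X) : Prop :=
  ∀ (Z : Set Baire) (ν : Z → X), Z ∈ Γ Baire → Continuous ν →
    {p | ∃ h : p ∈ Z, ν ⟨p, h⟩ ∈ A} ∈ Γ Baire

theorem Definable.preimage {A : Set X} {f : Y → X} (hA : Definable Γ A) (hf : SCont f) :
    Definable Γ (f ⁻¹' A) :=
  fun Z ν hZ hν ↦ hA Z (f ∘ ν) hZ (hf.comp hν.continuousGeneratedBy).continuous

variable [ProjectivelyClosed Γ]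

/-- Representations may be given on subsets of retracts of the Baire space. -/
theorem isRepresentable_of_retract {T : Type} [TopologicalSpace T] (hT : IsBaireRetract T)
    {D : Set T} {δ : D → X} (hs : Function.Surjective δ) (hc : Continuous δ)
    (hf : ∀ (Z : Set Baire) (ν : Z → X), Continuous ν →
      ∃ g : Z → D, Continuous g ∧ ∀ z, δ (g z) = ν z)
    (hE : {r : T × T | ∃ (h₁ : r.1 ∈ D) (h₂ : r.2 ∈ D), δ ⟨r.1, h₁⟩ = δ ⟨r.2, h₂⟩} ∈ Γ (T × T)) :
    IsRepresentable Γ X := by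
  obtain ⟨e, s, he, hs', h⟩ := hT
  refine ⟨e ⁻¹' D, fun p ↦ δ ⟨e p, p.2⟩, ⟨?_, ?_, ?_⟩, preimage_mem (he.prodMap he) hE⟩
  · intro x
    obtain ⟨t, rfl⟩ := hs x
    exact ⟨⟨s t, by simp [h]⟩, by simp [h]⟩
  · exact hc.comp ((he.comp continuous_subtype_val).subtype_mk _)
  · intro Z ν hν
    obtain ⟨g, hg, hgν⟩ := hf Z ν hν
    refine ⟨fun z ↦ ⟨s (g z), by simp [h]⟩,
      (hs'.comp (continuous_subtype_val.comp hg)).subtype_mk fun z ↦ by simp [h], ?_⟩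
    ext z
    simp [h, hgν]

/-! ### Definable sets -/

namespace Definable

variable {A B : Set X}

theorem mem_of_retract (hA : Definable Γ A) {T : Type} [TopologicalSpace T]
    (hT : IsBaireRetract T) {Z : Set T} (hZ : Z ∈ Γ T) {ν : Z → X} (hν : Continuous ν) :
    {t | ∃ h : t ∈ Z, ν ⟨t, h⟩ ∈ A} ∈ Γ T := by
  obtain ⟨e, s, he, hs, h⟩ := hT
  convert preimage_mem hs (hA (e ⁻¹' Z) (fun p ↦ ν ⟨e p, p.2⟩) (preimage_mem he hZ)
    (hν.comp ((he.comp continuous_subtype_val).subtype_mk _))) using 1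
  ext t
  simp [h]

theorem of_isOpen (hA : IsOpen A) : Definable Γ A := fun Z ν hZ hν ↦ by
  obtain ⟨U, hU, h⟩ := isOpen_induced_iff.1 (hA.preimage hν)
  convert inter_mem hZ (isOpen_mem (Γ := Γ) hU) using 1
  ext p
  constructor
  · rintro ⟨hp, hA⟩
    exact ⟨hp, h.ge (show (⟨p, hp⟩ : Z) ∈ ν ⁻¹' A from hA)⟩
  · rintro ⟨hp, hA⟩
    exact ⟨hp, h.le (show (⟨p, hp⟩ : Z) ∈ Subtype.val ⁻¹' U from hA)⟩

theorem compl (hA : Definable Γ A) : Definable Γ Aᶜ := fun Z ν hZ hν ↦ by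
  convert inter_mem hZ (compl_mem (hA Z ν hZ hν)) using 1
  ext p
  constructor
  · rintro ⟨h, hp⟩
    exact ⟨h, fun ⟨_, hp'⟩ ↦ hp hp'⟩
  · rintro ⟨h, hp⟩
    exact ⟨h, fun hp' ↦ hp ⟨h, hp'⟩⟩

theorem iInter {ι : Sort*} [Countable ι] {A : ι → Set X} (hA : ∀ i, Definable Γ (A i)) :
    Definable Γ (⋂ i, A i) := fun Z ν hZ hν ↦ by
  convert inter_mem hZ (iInter_countable_mem fun i ↦ hA i Z ν hZ hν) using 1
  ext p
  simp only [mem_iInter, mem_inter_iff]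
  exact ⟨fun ⟨h, hp⟩ ↦ ⟨h, fun i ↦ ⟨h, hp i⟩⟩, fun ⟨h, hp⟩ ↦ ⟨h, fun i ↦ (hp i).2⟩⟩

theorem iUnion {ι : Sort*} [Countable ι] {A : ι → Set X} (hA : ∀ i, Definable Γ (A i)) :
    Definable Γ (⋃ i, A i) := by
  rw [← compl_compl (⋃ i, A i), compl_iUnion]
  exact (iInter fun i ↦ (hA i).compl).compl

theorem inter (hA : Definable Γ A) (hB : Definable Γ B) : Definable Γ (A ∩ B) := by
  rw [inter_eq_iInter]; exact iInter (by rintro (_ | _) <;> assumption)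

theorem union (hA : Definable Γ A) (hB : Definable Γ B) : Definable Γ (A ∪ B) := by
  rw [← compl_compl (A ∪ B), compl_union]; exact (hA.compl.inter hB.compl).compl

theorem imp {p q : X → Prop} (hp : Definable Γ {x | p x}) (hq : Definable Γ {x | q x}) :
    Definable Γ {x | p x → q x} := by
  convert hp.compl.union hq using 1
  ext x
  simp [imp_iff_not_or]

theorem iff {p q : X → Prop} (hp : Definable Γ {x | p x}) (hq : Definable Γ {x | q x}) :
    Definable Γ {x | p x ↔ q x} := by
  convert (hp.imp hq).inter (hq.imp hp) using 1
  ext x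
  simp [iff_iff_implies_and_implies]

theorem of_scont_prop {p : X → Prop} (hp : SCont p) : Definable Γ {x | p x} :=
  (of_isOpen (Γ := Γ) isOpen_singleton_true).preimage hp |> fun h ↦ by simpa [preimage] using h

end Definable

theorem IsRepresentable.exists_mem (h : IsRepresentable Γ X) :
    ∃ (D : Set Baire) (δ : D → X), IsAdmissible δ ∧ D ∈ Γ Baire ∧ EQ δ ∈ Γ (Baire × Baire) := by
  obtain ⟨D, δ, hδ, hE⟩ := h
  refine ⟨D, δ, hδ, ?_, hE⟩
  convert preimage_mem (f := fun p : Baire ↦ (p, p)) (by fun_prop) hE using 1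
  ext p
  simp [EQ]

/-- Along a test function both sides lift continuously to names, and the lifted pair pulls back `EQ
δ`. -/
theorem IsRepresentable.definable_eq (h : IsRepresentable Γ X) {f g : Y → X} (hf : SCont f)
    (hg : SCont g) : Definable Γ {y | f y = g y} := fun Z ν hZ hν ↦ by
  obtain ⟨D, δ, hδ, hE⟩ := h
  obtain ⟨f', hf', hf''⟩ := hδ.factors Z (f ∘ ν) (hf.comp hν.continuousGeneratedBy).continuous
  obtain ⟨g', hg', hg''⟩ := hδ.factors Z (g ∘ ν) (hg.comp hν.continuousGeneratedBy).continuous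
  convert partial_preimage_mem_of_retract isBaireRetract_baire_prod hZ
    (g := fun z ↦ ((f' z : Baire), (g' z : Baire)))
    ((continuous_subtype_val.comp hf').prodMk (continuous_subtype_val.comp hg')) hE using 1
  ext p
  simp only [EQ, mem_ofPred_eq]
  refine exists_congr fun h ↦ ?_
  have h₁ := congrFun hf'' ⟨p, h⟩
  have h₂ := congrFun hg'' ⟨p, h⟩
  simp only [Function.comp_apply] at h₁ h₂
  simp [h₁, h₂]

/-- A witness `x` may be replaced by a name of it, which turns the quantifier into a projection
along the Baire space. -/
theorem Definable.exists (hX : IsRepresentable Γ X) {A : Set (X × Y)} (hA : Definable Γ A) :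
    Definable Γ {y | ∃ x, (x, y) ∈ A} := fun Z ν hZ hν ↦ by
  obtain ⟨D, δ, hδ, hD, -⟩ := hX.exists_mem
  have hDZ : {r : Baire × Baire | r.1 ∈ D ∧ r.2 ∈ Z} ∈ Γ (Baire × Baire) :=
    inter_mem (preimage_mem continuous_fst hD) (preimage_mem continuous_snd hZ)
  have hc : Continuous fun r : {r : Baire × Baire | r.1 ∈ D ∧ r.2 ∈ Z} ↦
      (δ ⟨r.1.1, r.2.1⟩, ν ⟨r.1.2, r.2.2⟩) :=
    (hδ.continuous.comp ((continuous_fst.comp continuous_subtype_val).subtype_mk _)).prodMk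
      (hν.comp ((continuous_snd.comp continuous_subtype_val).subtype_mk _))
  convert projection_mem (hA.mem_of_retract isBaireRetract_baire_prod hDZ hc) using 1
  ext p
  constructor
  · rintro ⟨h, x, hx⟩
    obtain ⟨d, rfl⟩ := hδ.surjective x
    exact ⟨d, ⟨d.2, h⟩, hx⟩
  · rintro ⟨q, ⟨h₁, h₂⟩, hx⟩
    exact ⟨h₂, _, hx⟩

theorem Definable.forall (hX : IsRepresentable Γ X) {p : X → Y → Prop}
    (hp : Definable Γ {r : X × Y | p r.1 r.2}) : Definable Γ {y | ∀ x, p x y} := by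
  convert (Definable.exists hX hp.compl).compl using 1
  ext y
  simp

/-- A representation on a set in the pointclass shows a space with definable equality to be
representable. -/
theorem isRepresentable_of_definable_diagonal {T : Type} [TopologicalSpace T]
    (hT : IsBaireRetract T)
    {D : Set T} (hD : D ∈ Γ T) {δ : D → X} (hs : Function.Surjective δ) (hc : Continuous δ)
    (hf : ∀ (Z : Set Baire) (ν : Z → X), Continuous ν →
      ∃ g : Z → D, Continuous g ∧ ∀ z, δ (g z) = ν z)
    (hE : Definable Γ {r : X × X | r.1 = r.2}) :
    IsRepresentable Γ X := by
  refine isRepresentable_of_retract hT hs hc hf ?_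
  have hDD : {r : T × T | r.1 ∈ D ∧ r.2 ∈ D} ∈ Γ (T × T) :=
    inter_mem (preimage_mem continuous_fst hD) (preimage_mem continuous_snd hD)
  have hc' : Continuous fun r : {r : T × T | r.1 ∈ D ∧ r.2 ∈ D} ↦
      (δ ⟨r.1.1, r.2.1⟩, δ ⟨r.1.2, r.2.2⟩) :=
    (hc.comp ((continuous_fst.comp continuous_subtype_val).subtype_mk _)).prodMk
      (hc.comp ((continuous_snd.comp continuous_subtype_val).subtype_mk _))
  convert hE.mem_of_retract (hT.prod hT) hDD hc' using 1
  ext r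
  exact ⟨fun ⟨h₁, h₂, h⟩ ↦ ⟨⟨h₁, h₂⟩, h⟩, fun ⟨⟨h₁, h₂⟩, h⟩ ↦ ⟨h₁, h₂, h⟩⟩

end

/-! ### Codes for partial continuous functions on the Baire space -/

section Codes

open PiNat

theorem eventually_res_eq (x : Baire) (k : ℕ) : ∀ᶠ y in 𝓝 x, res y k = res x k := by
  filter_upwards [(isOpen_cylinder (fun _ ↦ ℕ) x k).mem_nhds (self_mem_cylinder x k)] with y hy
  exact res_eq_res.2 fun m hm ↦ mem_cylinder_iff.1 hy m hm

theorem continuous_comp_res {α : Type*} [TopologicalSpace α] (F : List ℕ → α) (k : ℕ) :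
    Continuous fun x : Baire ↦ F (res x k) :=
  continuous_iff_continuousAt.2 fun x ↦
    (continuousAt_const (y := F (res x k))).congr
      ((eventually_res_eq x k).mono fun _ hy ↦ congrArg F hy.symm)

/-- The space of codes. A code assigns to a finite sequence `l` and a number `n` either no
information, or information on the `n`-th term of the value on all extensions of `l`. -/
abbrev Code : Type := List ℕ × ℕ → ℕ

theorem continuous_code_apply (k n : ℕ) :
    Continuous fun r : Code × Baire ↦ r.1 (res r.2 k, n) :=
  continuous_iff_continuousAt.2 fun r ↦ by
    have h : ContinuousAt (fun r' : Code × Baire ↦ r'.1 (res r.2 k, n)) r := by fun_prop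
    refine h.congr ?_
    filter_upwards [continuous_snd.continuousAt.eventually (eventually_res_eq r.2 k)] with r' hr'
    rw [hr']

/-- The set of the codes and the arguments on which they converge. -/
def codeDomain : Set (Code × Baire) := {r | ∀ n, ∃ k, r.1 (res r.2 k, n) ≠ 0}

/-- The universal partial continuous function. -/
def codeEval (r : codeDomain) : Baire :=
  -- An entry `m + 1` announces the value `m`, as `0` is reserved for no information.
  fun n ↦ r.1.1 (res r.1.2 (Nat.find (r.2 n)), n) - 1

theorem codeDomain_mem {Γ : PointclassFamily.{0}} [ProjectivelyClosed Γ] :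
    codeDomain ∈ Γ (Code × Baire) := by
  have : codeDomain = ⋂ n, ⋃ k, {r : Code × Baire | r.1 (res r.2 k, n) ≠ 0} := by
    ext r; simp [codeDomain]
  rw [this]
  exact iInter_mem fun n ↦ iUnion_countable_mem fun k ↦ isOpen_mem <|
    (isOpen_discrete ({0}ᶜ : Set ℕ)).preimage (continuous_code_apply k n)

/-- The `n`-th term depends only on the code entries up to the first informative prefix. These
finitely many entries are locally constant, and hence so is the position of that prefix. -/
theorem continuous_codeEval : Continuous codeEval := by
  refine continuous_pi fun n ↦ continuous_iff_continuousAt.2 fun r ↦ ?_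
  set k := Nat.find (r.2 n) with hk
  have key : ∀ j, ∀ᶠ r' : codeDomain in 𝓝 r,
      r'.1.1 (res r'.1.2 j, n) = r.1.1 (res r.1.2 j, n) := fun j ↦
    ((continuous_code_apply j n).comp continuous_subtype_val).continuousAt.eventually
      ((isOpen_discrete {r.1.1 (res r.1.2 j, n)}).mem_nhds rfl)
  have hall : ∀ᶠ r' : codeDomain in 𝓝 r, ∀ j ∈ Finset.range (k + 1),
      r'.1.1 (res r'.1.2 j, n) = r.1.1 (res r.1.2 j, n) :=
    (Finset.range (k + 1)).eventually_all.2 fun j _ ↦ key j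
  refine continuousAt_const.congr (f := fun _ ↦ codeEval r n) ?_
  filter_upwards [hall] with r' hr'
  have : Nat.find (r'.2 n) = k := by
    rw [Nat.find_eq_iff]
    refine ⟨?_, fun j hj ↦ ?_⟩
    · rw [hr' k (by simp)]
      exact Nat.find_spec (r.2 n)
    · rw [hr' j (by simp; omega)]
      exact Nat.find_min (r.2 n) hj
  rw [codeEval, codeEval, this, hr' k (by simp)]

/-- The code of `z` is a modulus table: at `l` and `n` it records the `n`-th term of `G` if that
term is constant on the pairs whose prefixes are `l` and the equally long prefix of `z`. Reading
only a finite prefix of `z` makes each entry continuous in `z`. -/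
theorem exists_code {Z D : Set Baire} {G : Z × D → Baire} (hG : Continuous G) :
    ∃ g : Z → Code, Continuous g ∧
      ∀ z x, ∃ h : (g z, x.1) ∈ codeDomain, codeEval ⟨_, h⟩ = G (z, x) := by
  classical
  let P : List ℕ → List ℕ → ℕ → ℕ → Prop := fun s l n m ↦ ∀ (z' : Z) (x : D),
    res z'.1 l.length = s → res x.1 l.length = l → G (z', x) n = m
  let F : List ℕ → List ℕ → ℕ → ℕ := fun s l n ↦
    if h : ∃ m, P s l n m then h.choose + 1 else 0
  let g : Z → Code := fun z ln ↦ F (res z.1 ln.1.length) ln.1 ln.2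
  have hval : ∀ z x k n, g z (res x.1 k, n) ≠ 0 → g z (res x.1 k, n) = G (z, x) n + 1 := by
    intro z x k n h
    simp only [g, F, res_length] at h ⊢
    split_ifs at h ⊢ with hm
    · rw [hm.choose_spec z x (by simp) (by simp)]
    · simp at h
  have hdom : ∀ z (x : D), (g z, x.1) ∈ codeDomain := by
    intro z x n
    have hn : ∀ᶠ r in 𝓝 (z, x), G r n = G (z, x) n :=
      ((continuous_apply n).comp hG).continuousAt.eventually
        ((isOpen_discrete {G (z, x) n}).mem_nhds rfl)
    have hemb : IsEmbedding (Prod.map (Subtype.val : Z → Baire) (Subtype.val : D → Baire)) :=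
      IsEmbedding.subtypeVal.prodMap .subtypeVal
    rw [hemb.nhds_eq_comap, Prod.map_apply, nhds_prod_eq] at hn
    obtain ⟨V, hV, hVn⟩ := hn
    obtain ⟨A, hA, B, hB, hAB⟩ := mem_prod_iff.1 hV
    obtain ⟨_, ⟨y, i, rfl⟩, hyi, hiA⟩ :=
      (isTopologicalBasis_cylinders fun _ ↦ ℕ).mem_nhds_iff.1 hA
    obtain ⟨_, ⟨y', j, rfl⟩, hyj, hjB⟩ :=
      (isTopologicalBasis_cylinders fun _ ↦ ℕ).mem_nhds_iff.1 hB
    -- One length must serve both arguments, since the table compares prefixes of equal length.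
    refine ⟨max i j, ?_⟩
    have hex : ∃ m, P (res z.1 (max i j)) (res x.1 (max i j)) n m := by
      refine ⟨G (z, x) n, fun z' x' hz' hx' ↦ hVn (hAB ⟨hiA ?_, hjB ?_⟩)⟩
      · rw [res_length, res_eq_res] at hz'
        rw [mem_cylinder_iff] at hyi ⊢
        exact fun m hm ↦ (hz' (lt_max_of_lt_left hm)).trans (hyi m hm)
      · rw [res_length, res_eq_res] at hx'
        rw [mem_cylinder_iff] at hyj ⊢
        exact fun m hm ↦ (hx' (lt_max_of_lt_right hm)).trans (hyj m hm)
    simp only [g, F, res_length]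
    rw [dif_pos hex]
    exact Nat.succ_ne_zero _
  refine ⟨g, continuous_pi fun ln ↦
    (continuous_comp_res (fun s ↦ F s ln.1 ln.2) ln.1.length).comp continuous_subtype_val,
    fun z x ↦ ⟨hdom z x, funext fun n ↦ ?_⟩⟩
  exact (congrArg (· - 1) (hval z x _ n (Nat.find_spec (hdom z x n)))).trans
    (Nat.add_sub_cancel _ _)

end Codes

/-! ### Realizers of functions -/

section Realizers

variable {X : Type u} {Y : Type v}

/-- The code `p` realizes the function `f` with respect to the given representations. -/
def Realizes {D : Set Baire} (δ : D → X) {E : Set Baire} (ε : E → Y) (p : Code) (f : X → Y) :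
    Prop :=
  ∀ x : D, ∃ (h : (p, x.1) ∈ codeDomain) (h' : codeEval ⟨_, h⟩ ∈ E), ε ⟨_, h'⟩ = f (δ x)

theorem Realizes.unique {D : Set Baire} {δ : D → X} {E : Set Baire} {ε : E → Y}
    (hδ : Function.Surjective δ) {p : Code} {f g : X → Y}
    (hf : Realizes δ ε p f) (hg : Realizes δ ε p g) : f = g := by
  ext x
  obtain ⟨d, rfl⟩ := hδ x
  obtain ⟨_, _, h⟩ := hf d
  obtain ⟨_, _, h'⟩ := hg d
  exact h.symm.trans h'

end Realizers

/-! ### Function spaces -/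

section FunctionSpace

variable {X : Type u} {Y : Type v} {W : Type w} [TopologicalSpace X] [TopologicalSpace Y]
  [TopologicalSpace W] {Γ : PointclassFamily.{0}}

theorem scont_eval {f : W → X} {F : W → SMap X Y} (hf : SCont f) (hF : SCont F) :
    SCont fun w ↦ F w (f w) :=
  (ContinuousMapGeneratedBy.ev (X := ConvSeq) (Y := X) (Z := Y)).prop.comp (hf.prodMk hF)

theorem scont_curry {F : W → SMap X Y} (hF : SCont fun r : X × W ↦ F r.2 r.1) : SCont F :=
  (ContinuousMapGeneratedBy.curryEquiv (X := ConvSeq) ⟨_, hF⟩).prop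

variable {D : Set Baire} {δ : D → X} {E : Set Baire} {ε : E → Y}

/-- Sequential continuity into the function space is joint continuity along pairs of sequences in
`W` and `X`. Lifting the sequence in `X` to names reduces this to continuity of `codeEval`. -/
theorem continuous_of_realizes (hδ : IsAdmissible δ) (hε : Continuous ε) {c : W → Code}
    (hc : Continuous c) {F : W → SMap X Y} (hF : ∀ w, Realizes δ ε (c w) (F w)) : SCont F := by
  refine (ContinuousMapGeneratedBy.continuousGeneratedBy_iff_uncurry (X := ConvSeq) F).2 ?_
  rintro _ φ _ ψ
  obtain ⟨ψ', hψ', hψψ⟩ := hδ.exists_lift isEmbedding_convSeqToBaire ψ.continuous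
  have h₁ : ∀ r : OnePoint ℕ × OnePoint ℕ, (c (φ r.1), (ψ' r.2).1) ∈ codeDomain :=
    fun r ↦ (hF (φ r.1) (ψ' r.2)).1
  have h₂ : ∀ r, codeEval ⟨_, h₁ r⟩ ∈ E := fun r ↦ (hF (φ r.1) (ψ' r.2)).2.1
  have h₃ : (fun r : OnePoint ℕ × OnePoint ℕ ↦ F (φ r.1) (ψ r.2)) =
      fun r ↦ ε ⟨codeEval ⟨_, h₁ r⟩, h₂ r⟩ := by
    ext r
    rw [(hF (φ r.1) (ψ' r.2)).2.2, hψψ]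
  change Continuous (fun r : OnePoint ℕ × OnePoint ℕ ↦ F (φ r.1) (ψ r.2))
  rw [h₃]
  refine hε.comp ((continuous_codeEval.comp (Continuous.subtype_mk ?_ _)).subtype_mk _)
  exact (hc.comp (φ.continuous.comp continuous_fst)).prodMk
    (continuous_subtype_val.comp (hψ'.comp continuous_snd))

/-- This eliminates the quantifier over functions: only pairs of names remain, so the set of
realizers lies in the pointclass. The induced function is sequentially continuous because sequences
lift to names. -/
theorem exists_realizes_iff (hδ : IsAdmissible δ) (hε : Continuous ε) (p : Code) :
    (∃ f : SMap X Y, Realizes δ ε p f) ↔ ∀ r ∈ EQ δ,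
      ∃ h : (p, r.1) ∈ codeDomain ∧ (p, r.2) ∈ codeDomain,
        (codeEval ⟨_, h.1⟩, codeEval ⟨_, h.2⟩) ∈ EQ ε := by
  constructor
  · rintro ⟨f, hf⟩ ⟨a, b⟩ ⟨ha, hb, hab⟩
    obtain ⟨h₁, h₁', h₁''⟩ := hf ⟨a, ha⟩
    obtain ⟨h₂, h₂', h₂''⟩ := hf ⟨b, hb⟩
    exact ⟨⟨h₁, h₂⟩, h₁', h₂', by rw [h₁'', h₂'', hab]⟩
  · intro H
    have hd : ∀ x : D, (p, x.1) ∈ codeDomain := fun x ↦ (H (x, x) ⟨x.2, x.2, rfl⟩).1.1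
    have he : ∀ x : D, codeEval ⟨_, hd x⟩ ∈ E := fun x ↦ (H (x, x) ⟨x.2, x.2, rfl⟩).2.1
    choose s hs using hδ.surjective
    have hfac : ∀ x : D, ε ⟨_, he x⟩ = ε ⟨_, he (s (δ x))⟩ := fun x ↦
      (H (x, s (δ x)) ⟨x.2, (s (δ x)).2, (hs _).symm⟩).2.2.2
    refine ⟨⟨fun x ↦ ε ⟨_, he (s x)⟩, fun _ φ ↦ ?_⟩, fun x ↦ ⟨hd x, he x, hfac x⟩⟩
    obtain ⟨φ', hφ', hφφ⟩ := hδ.exists_lift isEmbedding_convSeqToBaire φ.continuous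
    have : (fun x ↦ ε ⟨_, he (s x)⟩) ∘ φ = fun n ↦ ε ⟨_, he (φ' n)⟩ := by
      ext n
      rw [hfac (φ' n), hφφ]
      rfl
    rw [this]
    refine hε.comp ((continuous_codeEval.comp (Continuous.subtype_mk ?_ _)).subtype_mk _)
    exact continuous_const.prodMk (continuous_subtype_val.comp hφ')

/-- Uncurried, `ν` is continuous on `Z × D`. This space embeds in the Baire space, so admissibility
of `ε` gives a lift, which `exists_code` turns into codes. -/
theorem exists_continuous_realizes (hδ : IsAdmissible δ) (hε : IsAdmissible ε) {Z : Set Baire}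
    {ν : Z → SMap X Y} (hν : SCont ν) :
    ∃ g : Z → Code, Continuous g ∧ ∀ z, Realizes δ ε (g z) (ν z) := by
  have hG : Continuous fun r : Z × D ↦ ν r.1 (δ r.2) :=
    (scont_eval (hδ.continuous.comp continuous_snd).continuousGeneratedBy
      (hν.comp continuous_fst.continuousGeneratedBy)).continuous
  obtain ⟨e, he⟩ := isBaireRetract_baire_prod.exists_isEmbedding
  obtain ⟨G, hG', hGG⟩ := hε.exists_lift
    (he.comp (IsEmbedding.subtypeVal.prodMap IsEmbedding.subtypeVal)) hG
  obtain ⟨g, hg, hgG⟩ := exists_code (continuous_subtype_val.comp hG')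
  refine ⟨g, hg, fun z x ↦ ?_⟩
  obtain ⟨h, h'⟩ := hgG z x
  refine ⟨h, by rw [h']; exact (G (z, x)).2, ?_⟩
  rw [← hGG (z, x)]
  congr 1
  exact Subtype.ext h'

theorem IsRepresentable.functionSpace [ProjectivelyClosed Γ] (hX : IsRepresentable Γ X)
    (hY : IsRepresentable Γ Y) : IsRepresentable Γ (SMap X Y) := by
  obtain ⟨D, δ, hδ, hδΓ⟩ := id hX
  obtain ⟨E, ε, hε, hεΓ⟩ := id hY
  have hT : IsBaireRetract Code := isBaireRetract_countable_pi _
  let R : Set Code := {p | ∃ f : SMap X Y, Realizes δ ε p f}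
  have hR : R ∈ Γ Code := by
    let Z : Set ((Baire × Baire) × Code) :=
      {s | (s.2, s.1.1) ∈ codeDomain ∧ (s.2, s.1.2) ∈ codeDomain}
    have hZ : Z ∈ Γ _ := inter_mem (preimage_mem (by fun_prop) codeDomain_mem)
      (preimage_mem (by fun_prop) codeDomain_mem)
    have hg : Continuous fun s : Z ↦
        ((codeEval ⟨_, s.2.1⟩, codeEval ⟨_, s.2.2⟩) : Baire × Baire) :=
      (continuous_codeEval.comp (Continuous.subtype_mk (by fun_prop) _)).prodMk
        (continuous_codeEval.comp (Continuous.subtype_mk (by fun_prop) _))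
    have h := compl_mem (exists_mem_of_retract isBaireRetract_baire_prod
      (inter_mem (preimage_mem continuous_fst hδΓ)
        (compl_mem (partial_preimage_mem_of_retract isBaireRetract_baire_prod hZ hg hεΓ))))
    convert h using 1
    ext p
    refine (exists_realizes_iff hδ hε.continuous p).trans ?_
    exact ⟨fun H ⟨r, hr, hn⟩ ↦ hn (H r hr), fun H r hr ↦ by
      by_contra hn; exact H ⟨r, hr, hn⟩⟩
  choose f hf using fun p : R ↦ p.2
  have hlift : ∀ (Z : Set Baire) (ν : Z → SMap X Y), Continuous ν →
      ∃ g : Z → R, Continuous g ∧ ∀ z, f (g z) = ν z := fun Z ν hν ↦ by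
    obtain ⟨g, hg, hgν⟩ := exists_continuous_realizes hδ hε hν.continuousGeneratedBy
    refine ⟨fun z ↦ ⟨g z, ν z, hgν z⟩, hg.subtype_mk _, fun z ↦ DFunLike.coe_injective ?_⟩
    exact (hf _).unique hδ.surjective (hgν z)
  refine isRepresentable_of_definable_diagonal hT hR (δ := f) (fun F ↦ ?_)
    (continuous_of_realizes hδ hε.continuous continuous_subtype_val hf).continuous hlift ?_
  · obtain ⟨g, -, hg⟩ := hlift univ (fun _ ↦ F) continuous_const
    exact ⟨g ⟨0, mem_univ _⟩, hg _⟩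
  · have : {r : SMap X Y × SMap X Y | r.1 = r.2} = {r | ∀ x, r.1 x = r.2 x} := by
      ext r
      exact DFunLike.ext_iff
    rw [this]
    refine Definable.forall hX (hY.definable_eq (scont_eval ?_ ?_) (scont_eval ?_ ?_)) <;>
      exact Continuous.continuousGeneratedBy (by fun_prop)

end FunctionSpace

/-! ### Constructions of representable spaces -/

section Constructions

variable {X : Type u} {Y : Type v} {W : Type w} [TopologicalSpace X] [TopologicalSpace Y]
  [TopologicalSpace W] {Γ : PointclassFamily.{0}}

theorem isRepresentable_of_isEmpty [ProjectivelyClosed Γ] [IsEmpty X] : IsRepresentable Γ X := by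
  refine isRepresentable_of_retract isBaireRetract_baire (D := ∅) (δ := fun d ↦ d.2.elim)
    (fun x ↦ isEmptyElim x) (continuous_of_const fun d ↦ d.2.elim)
    (fun Z ν _ ↦ ⟨fun z ↦ isEmptyElim (ν z), continuous_of_const fun z ↦ isEmptyElim (ν z),
      fun z ↦ isEmptyElim (ν z)⟩) ?_
  convert isOpen_mem (Γ := Γ) isOpen_empty using 1
  ext r
  simp

theorem isRepresentable_prop [ProjectivelyClosed Γ] : IsRepresentable Γ Prop := by
  classical
  have hopen : IsOpen {p : Baire | ∃ n, p n ≠ 0} := by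
    rw [ofPred_exists]
    exact isOpen_iUnion fun n ↦
      (isOpen_discrete ({0}ᶜ : Set ℕ)).preimage (continuous_apply (A := fun _ ↦ ℕ) n)
  have hlift : ∀ (Z : Set Baire) (ν : Z → Prop), Continuous ν →
      ∃ g : Z → (univ : Set Baire), Continuous g ∧ ∀ z, (∃ n, (g z).1 n ≠ 0) = ν z := by
    intro Z ν hν
    obtain ⟨U, hU, hUν⟩ := isOpen_induced_iff.1 (continuous_Prop.1 hν)
    -- The `n`-th term tests whether the first `n` terms of `z` already force membership in `U`.
    refine ⟨fun z ↦ ⟨fun n ↦ if {y | PiNat.res y n = PiNat.res z.1 n} ⊆ U then 1 else 0,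
      mem_univ _⟩, (continuous_pi fun n ↦ (continuous_comp_res
        (fun s ↦ if {y | PiNat.res y n = s} ⊆ U then 1 else 0) n).comp
          continuous_subtype_val).subtype_mk _, fun z ↦ ?_⟩
    have hz : ν z ↔ z.1 ∈ U := (Set.ext_iff.1 hUν z).symm
    refine propext (Iff.trans ?_ hz.symm)
    simp only [ne_eq, ite_eq_right_iff, one_ne_zero, imp_false, not_not]
    refine ⟨fun ⟨n, hn⟩ ↦ hn rfl, fun h ↦ ?_⟩
    obtain ⟨_, ⟨y, n, rfl⟩, hy, hyU⟩ :=
      (PiNat.isTopologicalBasis_cylinders fun _ ↦ ℕ).mem_nhds_iff.1 (hU.mem_nhds h)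
    refine ⟨n, fun x hx ↦ hyU ?_⟩
    rw [mem_ofPred_eq, PiNat.res_eq_res] at hx
    rw [PiNat.mem_cylinder_iff] at hy ⊢
    exact fun m hm ↦ (hx hm).trans (hy m hm)
  refine isRepresentable_of_definable_diagonal isBaireRetract_baire (isOpen_mem isOpen_univ)
    (δ := fun p ↦ ∃ n, p.1 n ≠ 0) (fun P ↦ ?_)
    (continuous_Prop.2 (hopen.preimage continuous_subtype_val)) hlift ?_
  · obtain ⟨g, -, hg⟩ := hlift univ (fun _ ↦ P) continuous_const
    exact ⟨g ⟨0, mem_univ _⟩, hg _⟩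
  · have h₁ : Definable Γ {r : Prop × Prop | r.1} := .of_isOpen (continuous_Prop.1 continuous_fst)
    have h₂ : Definable Γ {r : Prop × Prop | r.2} := .of_isOpen (continuous_Prop.1 continuous_snd)
    convert h₁.iff h₂ using 1
    ext r
    simp

theorem IsRepresentable.pi [ProjectivelyClosed Γ] {J : Type} [Countable J] {X : J → Type u}
    [∀ j, TopologicalSpace (X j)] (hX : ∀ j, IsRepresentable Γ (X j)) :
    IsRepresentable Γ (∀ j, X j) := by
  choose D δ hδ hD _ using fun j ↦ (hX j).exists_mem
  have hmem : {p : J → Baire | ∀ j, p j ∈ D j} ∈ Γ (J → Baire) := by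
    rw [ofPred_forall]
    exact iInter_countable_mem fun j ↦ preimage_mem (continuous_apply j) (hD j)
  refine isRepresentable_of_definable_diagonal (isBaireRetract_pi J) hmem
    (δ := fun p j ↦ δ j ⟨p.1 j, p.2 j⟩) (fun x ↦ ?_) (continuous_pi fun j ↦
      (hδ j).continuous.comp (((continuous_apply j).comp continuous_subtype_val).subtype_mk _))
      (fun Z ν hν ↦ ?_) ?_
  · choose p hp using fun j ↦ (hδ j).surjective (x j)
    exact ⟨⟨fun j ↦ p j, fun j ↦ (p j).2⟩, funext hp⟩
  · choose g hg hgν using fun j ↦ (hδ j).factors Z (fun z ↦ ν z j)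
      ((continuous_apply j).comp hν)
    refine ⟨fun z ↦ ⟨fun j ↦ g j z, fun j ↦ (g j z).2⟩, (continuous_pi fun j ↦
      continuous_subtype_val.comp (hg j)).subtype_mk _, fun z ↦ funext fun j ↦ ?_⟩
    exact (congrFun (hgν j) z).symm
  · have : {r : (∀ j, X j) × (∀ j, X j) | r.1 = r.2} = ⋂ j, {r | r.1 j = r.2 j} := by
      ext r
      simp [funext_iff]
    rw [this]
    exact .iInter fun j ↦ (hX j).definable_eq (Continuous.continuousGeneratedBy (by fun_prop))
      (Continuous.continuousGeneratedBy (by fun_prop))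

theorem IsRepresentable.prod [ProjectivelyClosed Γ] (hX : IsRepresentable Γ X)
    (hY : IsRepresentable Γ Y) : IsRepresentable Γ (X × Y) := by
  obtain ⟨D, δ, hδ, hD, -⟩ := hX.exists_mem
  obtain ⟨E, ε, hε, hE, -⟩ := hY.exists_mem
  refine isRepresentable_of_definable_diagonal isBaireRetract_baire_prod
    (D := {r | r.1 ∈ D ∧ r.2 ∈ E})
    (inter_mem (preimage_mem continuous_fst hD) (preimage_mem continuous_snd hE))
    (δ := fun r ↦ (δ ⟨r.1.1, r.2.1⟩, ε ⟨r.1.2, r.2.2⟩)) (fun ⟨x, y⟩ ↦ ?_)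
    ((hδ.continuous.comp (Continuous.subtype_mk (by fun_prop) _)).prodMk
      (hε.continuous.comp (Continuous.subtype_mk (by fun_prop) _))) (fun Z ν hν ↦ ?_) ?_
  · obtain ⟨p, rfl⟩ := hδ.surjective x
    obtain ⟨q, rfl⟩ := hε.surjective y
    exact ⟨⟨(p, q), p.2, q.2⟩, rfl⟩
  · obtain ⟨f, hf, hfν⟩ := hδ.factors Z _ (continuous_fst.comp hν)
    obtain ⟨g, hg, hgν⟩ := hε.factors Z _ (continuous_snd.comp hν)
    exact ⟨fun z ↦ ⟨(f z, g z), (f z).2, (g z).2⟩, ((continuous_subtype_val.comp hf).prodMk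
      (continuous_subtype_val.comp hg)).subtype_mk _,
      fun z ↦ Prod.ext (congrFun hfν z).symm (congrFun hgν z).symm⟩
  · have : {r : (X × Y) × (X × Y) | r.1 = r.2} =
        {r | r.1.1 = r.2.1} ∩ {r | r.1.2 = r.2.2} := by
      ext r
      exact Prod.ext_iff
    rw [this]
    exact (hX.definable_eq (Continuous.continuousGeneratedBy (by fun_prop))
      (Continuous.continuousGeneratedBy (by fun_prop))).inter
        (hY.definable_eq (Continuous.continuousGeneratedBy (by fun_prop))
      (Continuous.continuousGeneratedBy (by fun_prop)))

/-- A space with a sequentially initial injection into a representable space is representable, if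
the image is definable. -/
theorem IsRepresentable.of_injective [ProjectivelyClosed Γ] (hX : IsRepresentable Γ X) {i : Y → X}
    (hi : Function.Injective i) (hc : SCont i)
    (hind : ∀ (Z : Set Baire) (ν : Z → Y), Continuous (i ∘ ν) → Continuous ν)
    (hdef : Definable Γ (range i)) : IsRepresentable Γ Y := by
  obtain ⟨D, δ, hδ, hD, -⟩ := hX.exists_mem
  -- The representation of `Y` is that of `X` restricted to the names of points in the image.
  have hD' := hdef D δ hD hδ.continuous
  choose f hf using fun p : {p | ∃ h : p ∈ D, δ ⟨p, h⟩ ∈ range i} ↦ p.2.2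
  have hfc : Continuous f := by
    refine hind _ _ ?_
    rw [show i ∘ f = fun p ↦ δ ⟨p.1, p.2.1⟩ from funext hf]
    exact hδ.continuous.comp (continuous_subtype_val.subtype_mk _)
  refine isRepresentable_of_definable_diagonal isBaireRetract_baire hD' (δ := f) (fun y ↦ ?_) hfc
    (fun Z ν hν ↦ ?_) ?_
  · obtain ⟨d, hd⟩ := hδ.surjective (i y)
    refine ⟨⟨d, d.2, y, hd.symm⟩, hi ?_⟩
    exact (hf _).trans hd
  · obtain ⟨g, hg, hgν⟩ := hδ.factors Z (i ∘ ν) (hc.comp hν.continuousGeneratedBy).continuous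
    have hgν' : ∀ z, δ (g z) = i (ν z) := fun z ↦ (congrFun hgν z).symm
    refine ⟨fun z ↦ ⟨g z, (g z).2, ν z, (hgν' z).symm⟩,
      (continuous_subtype_val.comp hg).subtype_mk _, fun z ↦ hi ?_⟩
    rw [hf]
    exact hgν' z
  · convert hX.definable_eq (Y := Y × Y) (hc.comp continuous_fst.continuousGeneratedBy)
      (hc.comp continuous_snd.continuousGeneratedBy) using 1
    ext r
    exact hi.eq_iff.symm

theorem IsRepresentable.subtype [ProjectivelyClosed Γ] (hX : IsRepresentable Γ X) {p : X → Prop}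
    (hp : Definable Γ {x | p x}) : IsRepresentable Γ {x // p x} :=
  hX.of_injective Subtype.val_injective continuous_subtype_val.continuousGeneratedBy
    (fun _ _ h ↦ IsEmbedding.subtypeVal.continuous_iff.2 h) (by convert hp; exact Subtype.range_coe)

theorem continuous_of_fibers {J : Type*} [TopologicalSpace J] [DiscreteTopology J] {c : X → J}
    (hc : Continuous c) {f : X → Y} (h : ∀ j, Continuous fun x : {x // c x = j} ↦ f x) :
    Continuous f :=
  continuous_iff_continuousAt.2 fun x ↦
    (continuousOn_iff_continuous_domRestrict.2 (h (c x))).continuousAt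
      (((isOpen_discrete {c x}).preimage hc).mem_nhds rfl)

theorem IsRepresentable.sigma [ProjectivelyClosed Γ] {J : Type} [Countable J] {X : J → Type u}
    [∀ j, TopologicalSpace (X j)] (hX : ∀ j, IsRepresentable Γ (X j)) :
    IsRepresentable Γ (Σ j, X j) := by
  cases isEmpty_or_nonempty J
  · exact isRepresentable_of_isEmpty
  obtain ⟨_⟩ := nonempty_encodable J
  let _ : TopologicalSpace J := ⊥
  have _ : DiscreteTopology J := ⟨rfl⟩
  have hT : IsBaireRetract (J × Baire) := by
    inhabit J
    refine isBaireRetract_nat_prod.of_retract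
      -- Numbers that encode nothing need some index, which is why the empty index type is treated
      -- apart.
      (Prod.map (fun n ↦ (Encodable.decode n).getD default) id) (Prod.map Encodable.encode id)
      (continuous_of_discreteTopology.prodMap continuous_id)
      (continuous_of_discreteTopology.prodMap continuous_id) fun t ↦ Prod.ext (by simp) rfl
  choose D δ hδ hE using hX
  let E : Set (J × Baire) := {t | t.2 ∈ D t.1}
  refine isRepresentable_of_retract hT (D := E) (δ := fun t ↦ ⟨t.1.1, δ t.1.1 ⟨t.1.2, t.2⟩⟩)
    ?_ ?_ ?_ ?_
  · rintro ⟨j, x⟩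
    obtain ⟨d, rfl⟩ := (hδ j).surjective x
    exact ⟨⟨(j, d), d.2⟩, rfl⟩
  · refine continuous_of_fibers (c := fun t : E ↦ t.1.1) (by fun_prop) fun j ↦ ?_
    have aux : ∀ t : {t : E // t.1.1 = j}, t.1.1.2 ∈ D j := by
      rintro ⟨⟨⟨j, p⟩, hp⟩, rfl⟩
      exact hp
    have : (fun t : {t : E // t.1.1 = j} ↦ (⟨t.1.1.1, δ t.1.1.1 ⟨t.1.1.2, t.1.2⟩⟩ : Σ j, X j)) =
        fun t ↦ ⟨j, δ j ⟨t.1.1.2, aux t⟩⟩ := by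
      refine funext ?_
      rintro ⟨⟨⟨j, p⟩, hp⟩, rfl⟩
      rfl
    rw [this]
    exact continuous_sigmaMk.comp ((hδ _).continuous.comp
      (Continuous.subtype_mk (by fun_prop) _))
  · intro Z ν hν
    have hνj : ∀ j, Continuous fun z : {z : Z // (ν z).1 = j} ↦ z.2 ▸ (ν z.1).2 := fun j ↦ by
      rw [(IsEmbedding.sigmaMk (i := j)).continuous_iff]
      convert hν.comp continuous_subtype_val using 1
      refine funext ?_
      rintro ⟨z, rfl⟩
      rfl
    choose g hg hgν using fun j ↦ (hδ j).exists_lift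
      (IsEmbedding.subtypeVal.comp IsEmbedding.subtypeVal) (hνj j)
    refine ⟨fun z ↦ ⟨((ν z).1, g (ν z).1 ⟨z, rfl⟩), (g (ν z).1 ⟨z, rfl⟩).2⟩,
      Continuous.subtype_mk ?_ _, fun z ↦ by simp [hgν]⟩
    have hc : Continuous fun z ↦ (ν z).1 :=
      (continuous_sigma fun j ↦ continuous_const : Continuous (Sigma.fst : (Σ j, X j) → J)).comp hν
    refine continuous_of_fibers hc fun j ↦ ?_
    have : (fun z : {z : Z // (ν z).1 = j} ↦
        (((ν z.1).1, (g (ν z.1).1 ⟨z.1, rfl⟩).1) : J × Baire)) = fun z ↦ (j, (g j z).1) := by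
      refine funext ?_
      rintro ⟨z, rfl⟩
      rfl
    rw [this]
    exact continuous_const.prodMk (continuous_subtype_val.comp (hg j))
  · have : {r : (J × Baire) × (J × Baire) | ∃ (h₁ : r.1 ∈ E) (h₂ : r.2 ∈ E),
        (⟨r.1.1, δ r.1.1 ⟨r.1.2, h₁⟩⟩ : Σ j, X j) = ⟨r.2.1, δ r.2.1 ⟨r.2.2, h₂⟩⟩} =
        ⋃ j, ({r | r.1.1 = j} ∩ {r | r.2.1 = j}) ∩ (fun r ↦ (r.1.2, r.2.2)) ⁻¹' EQ (δ j) := by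
      ext ⟨⟨j, p⟩, ⟨k, q⟩⟩
      simp only [mem_ofPred_eq, mem_iUnion, mem_inter_iff, mem_preimage, EQ]
      constructor
      · rintro ⟨h₁, h₂, h⟩
        obtain ⟨rfl, h⟩ := Sigma.mk.inj_iff.1 h
        exact ⟨j, ⟨rfl, rfl⟩, h₁, h₂, eq_of_heq h⟩
      · rintro ⟨_, ⟨rfl, rfl⟩, h₁, h₂, h⟩
        exact ⟨h₁, h₂, by rw [h]⟩
    rw [this]
    refine iUnion_countable_mem fun j ↦ inter_mem (inter_mem (isOpen_mem ?_) (isOpen_mem ?_))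
      (preimage_mem (by fun_prop) (hE j))
    · exact (isOpen_discrete {j}).preimage (continuous_fst.comp continuous_fst)
    · exact (isOpen_discrete {j}).preimage (continuous_fst.comp continuous_snd)

end Constructions

/-! ### Quotients -/

section Quotients

variable {X : Type u} {Y : Type v} {W : Type w} [TopologicalSpace X] [TopologicalSpace Y]
  [TopologicalSpace W] {Γ : PointclassFamily.{0}}

/-- The `T₀` quotients of representable spaces by definable relations are representable. The
quotient embeds into the second dual with respect to the Sierpiński space. -/
theorem IsRepresentable.quotient [ProjectivelyClosed Γ] [IsGeneratedBy ConvSeq X] [T0Space Y]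
    (hX : IsRepresentable Γ X) {q : X → Y} (hq : IsQuotientMap q) {R : X → X → Prop}
    (hR : Definable Γ {r : X × X | R r.1 r.2})
    (hqR : ∀ x x', R x x' → q x = q x')
    (hRq : ∀ V : Set X, IsOpen V → (∀ x x', R x x' → (x ∈ V ↔ x' ∈ V)) →
      ∃ U, IsOpen U ∧ q ⁻¹' U = V) : IsRepresentable Γ Y := by
  -- `E` stands for the topology of `Y`: by `hqR` and `hRq` its members are the preimages of the
  -- open sets of `Y`. Only `R` needs to be definable, not the kernel of `q`.
  let E := {F : SMap X Prop // ∀ x x', R x x' → (F x ↔ F x')}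
  have hE : IsRepresentable Γ E := by
    refine (hX.functionSpace isRepresentable_prop).subtype ?_
    refine Definable.forall hX (Definable.forall hX (Definable.imp ?_ (Definable.iff ?_ ?_)))
    · exact hR.preimage (f := fun s : X × (X × SMap X Prop) ↦ (s.2.1, s.1))
        (Continuous.continuousGeneratedBy (by fun_prop))
    · exact .of_scont_prop (scont_eval (Continuous.continuousGeneratedBy (by fun_prop))
        (Continuous.continuousGeneratedBy (by fun_prop)))
    · exact .of_scont_prop (scont_eval (Continuous.continuousGeneratedBy (by fun_prop))
        (Continuous.continuousGeneratedBy (by fun_prop)))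
  have hev : SCont fun r : X × E ↦ r.2.1 r.1 :=
    scont_eval continuous_fst.continuousGeneratedBy
      (continuous_subtype_val.comp continuous_snd).continuousGeneratedBy
  have hsat : ∀ (F : E) {x x'}, q x = q x' → (F.1 x ↔ F.1 x') := by
    intro F x x' h
    obtain ⟨U, -, hU⟩ := hRq {x | F.1 x} (continuous_Prop.1 F.1.prop.continuous) F.2
    have h₁ : ∀ x, F.1 x ↔ q x ∈ U := fun x ↦ (Set.ext_iff.1 hU x).symm
    rw [h₁, h₁, h]
  let F (U : Set Y) (hU : IsOpen U) : E :=
    ⟨⟨fun x ↦ q x ∈ U, Continuous.continuousGeneratedBy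
      (continuous_Prop.2 (hU.preimage hq.continuous))⟩,
      fun x x' h ↦ show q x ∈ U ↔ q x' ∈ U by rw [hqR x x' h]⟩
  choose s hs using hq.surjective
  let i : Y → SMap E Prop := fun y ↦ ⟨fun F ↦ F.1 (s y),
    hev.comp (f := fun F ↦ (s y, F)) (Continuous.continuousGeneratedBy (by fun_prop))⟩
  have hi : ∀ x F, i (q x) F = F.1 x := fun x F ↦ propext (hsat F (hs _))
  have hiF : ∀ y U hU, i y (F U hU) = (y ∈ U) := fun y U hU ↦
    congrArg (· ∈ U) (hs y)
  refine (hE.functionSpace isRepresentable_prop).of_injective (i := i) (fun y y' h ↦ ?_) ?_ ?_ ?_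
  · refine (inseparable_iff_forall_isOpen.2 fun U hU ↦ ?_).eq
    rw [← hiF y U hU, ← hiF y' U hU, h]
  -- Evaluation must be continuous along a sequence in `E × Y`, whose second component need not lift
  -- through `q`. Instead the sequence in `E` is fixed and all of `Y` is mapped into `SMap (OnePoint
  -- ℕ) Prop`; continuity of that map can be checked after composing with the quotient map `q`.
  · refine scont_curry fun _ φ ↦ ?_
    let k : Y → SMap (OnePoint ℕ) Prop := fun y ↦
      (i y).comp ⟨fun n ↦ (φ n).1, (continuous_fst.comp φ.continuous).continuousGeneratedBy⟩
    have hk : Continuous k := by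
      rw [hq.continuous_iff]
      refine (scont_curry ?_).continuous
      have : (fun r : OnePoint ℕ × X ↦ (k ∘ q) r.2 r.1) = fun r ↦ (φ r.1).1.1 r.2 :=
        funext fun r ↦ hi r.2 (φ r.1).1
      rw [this]
      exact hev.comp (f := fun r : OnePoint ℕ × X ↦ (r.2, (φ r.1).1))
        (Continuous.continuousGeneratedBy (by fun_prop))
    exact (scont_eval (f := fun n ↦ n) (F := fun n ↦ k (φ n).2)
      continuous_id.continuousGeneratedBy
      (hk.comp (continuous_snd.comp φ.continuous)).continuousGeneratedBy).continuous
  -- The preimage of `U` under `ν` is where `i ∘ ν` evaluates to true at the element `F U hU` of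
  -- `E`.
  · refine fun Z ν hν ↦ continuous_def.2 fun U hU ↦ ?_
    have h := scont_eval (f := fun _ : Z ↦ F U hU) continuous_const.continuousGeneratedBy
      hν.continuousGeneratedBy
    convert continuous_Prop.1 h.continuous using 1
    ext z
    simp [hiF]
  · have : range i = {G | ∃ x, (x, G) ∈ {r : X × SMap E Prop | ∀ F, r.2 F ↔ F.1 r.1}} := by
      ext G
      constructor
      · rintro ⟨y, rfl⟩
        exact ⟨s y, fun F ↦ Iff.rfl⟩
      · rintro ⟨x, h⟩
        exact ⟨q x, DFunLike.ext _ _ fun F ↦ (hi x F).trans (propext (h F).symm)⟩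
    rw [this]
    refine Definable.exists hX (Definable.forall hE (Definable.iff ?_ ?_))
    · exact .of_scont_prop (scont_eval (Continuous.continuousGeneratedBy (by fun_prop))
        (Continuous.continuousGeneratedBy (by fun_prop)))
    · exact .of_scont_prop (hev.comp (f := fun r : E × (X × SMap E Prop) ↦ (r.2.1, r.1))
        (Continuous.continuousGeneratedBy (by fun_prop)))

end Quotients

/-! ### qcb₀-spaces -/

section QCB

variable {X : Type u} [TopologicalSpace X] {Y : Type v} [TopologicalSpace Y]

theorem definable_allSets (A : Set X) : Definable allSets A := fun _ _ _ _ ↦ mem_univ _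

/-- A countable base embeds the space in a countable power of the Sierpiński space. -/
theorem isRepresentable_of_secondCountable [SecondCountableTopology X] [T0Space X] :
    IsRepresentable allSets X := by
  have hB := (TopologicalSpace.isBasis_countableBasis X).insert_empty
  obtain ⟨b, hb⟩ := ((TopologicalSpace.countable_countableBasis X).insert ∅).exists_eq_range
    (insert_nonempty _ _)
  rw [hb] at hB
  refine (IsRepresentable.pi fun _ : ℕ ↦ isRepresentable_prop).of_injective
    (i := fun x n ↦ x ∈ b n) (fun x y h ↦ ?_)
    (continuous_pi fun n ↦ continuous_Prop.2 (hB.isOpen ⟨n, rfl⟩)).continuousGeneratedBy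
    (fun Z ν hν ↦ ?_) (definable_allSets _)
  · refine Inseparable.eq (hB.inseparable_iff.2 ?_)
    rintro _ ⟨n, rfl⟩
    exact iff_of_eq (congrFun h n)
  · refine hB.continuous_iff.2 ?_
    rintro _ ⟨n, rfl⟩
    exact continuous_Prop.1 ((continuous_apply n).comp hν)

theorem IsQCB0.t0Space (h : IsQCB0 X) : T0Space X := h.1

theorem IsQCB0.isGeneratedBy (h : IsQCB0 X) : IsGeneratedBy ConvSeq X := by
  obtain ⟨_, A, _, q, _, hq⟩ := h
  exact hq.isGeneratedBy

/-- The countably based space may be replaced by its `T₀` reflection, as `X` is `T₀`. Then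
`IsRepresentable.quotient` applies, its definability condition being vacuous. -/
theorem IsQCB0.isRepresentable (h : IsQCB0 X) : IsRepresentable allSets X := by
  obtain ⟨_, A, _, q, _, hq⟩ := h
  have hA : SecondCountableTopology (SeparationQuotient A) :=
    SeparationQuotient.isQuotientMap_mk.secondCountableTopology SeparationQuotient.isOpenMap_mk
  let q' : SeparationQuotient A → X :=
    SeparationQuotient.lift q fun _ _ h ↦ (h.map hq.continuous).eq
  have hq' : IsQuotientMap q' :=
    .of_comp SeparationQuotient.continuous_mk (SeparationQuotient.continuous_lift hq.continuous) hq
  refine isRepresentable_of_secondCountable.quotient hq' (R := fun a b ↦ q' a = q' b)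
    (definable_allSets _) (fun _ _ ↦ id) fun V hV h ↦ ?_
  have hV' : q' ⁻¹' (q' '' V) = V := by
    refine (subset_preimage_image q' V).antisymm' ?_
    rintro a ⟨b, hb, hab⟩
    exact (h b a hab).1 hb
  exact ⟨q' '' V, hq'.isCoinducing.isOpen_preimage.1 (by rwa [hV']), hV'⟩

theorem IsRepresentable.isQCB0 {Γ : PointclassFamily.{0}} [T0Space X] [IsGeneratedBy ConvSeq X]
    (h : IsRepresentable Γ X) : IsQCB0 X := by
  obtain ⟨D, δ, hδ, -⟩ := h
  exact ⟨inferInstance, ULift.{u} D, inferInstance, δ ∘ ULift.down,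
    Homeomorph.ulift.secondCountableTopology, hδ.isQuotientMap.comp
      Homeomorph.ulift.isQuotientMap⟩

instance [T0Space X] : T0Space (Seq X) :=
  t0Space_of_injective_of_continuous WithGeneratedByTopology.equiv.injective continuous_fromSeq

instance [T0Space Y] : T0Space (SMap X Y) := by
  refine t0Space_of_injective_of_continuous (f := fun (F : SMap X Y) (x : X) ↦ F x)
    DFunLike.coe_injective (continuous_pi fun x ↦ ?_)
  -- Evaluation at `x` is restriction to the constant sequence `x`, evaluated at infinity.
  have h := ContinuousMapGeneratedBy.continuous_precomp (X := ConvSeq) (T := Y) (i := ())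
    (ContinuousMap.const (OnePoint ℕ) x)
  exact (continuous_eval_const (OnePoint.infty : OnePoint ℕ)).comp h

end QCB

/-! ### Universal `T₀` quotients -/

section T0Quotient

variable {X : Type u} [TopologicalSpace X] {Y : Type v} [TopologicalSpace Y]

/-- Two points are related if they belong to the same open sets that are invariant under `R`. -/
def t0Setoid (R : X → X → Prop) : Setoid X where
  r x y := ∀ V : Set X, IsOpen V → (∀ a b, R a b → (a ∈ V ↔ b ∈ V)) → (x ∈ V ↔ y ∈ V)
  iseqv := ⟨fun _ _ _ _ ↦ Iff.rfl, fun h V hV hR ↦ (h V hV hR).symm,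
    fun h h' V hV hR ↦ (h V hV hR).trans (h' V hV hR)⟩

/-- The universal `T₀` quotient by a relation. -/
abbrev T0Quotient (R : X → X → Prop) : Type u := Quotient (t0Setoid R)

variable {R : X → X → Prop}

theorem T0Quotient.sound {x y : X} (h : R x y) :
    (Quotient.mk _ x : T0Quotient R) = Quotient.mk _ y :=
  Quotient.sound fun _ _ hR ↦ hR x y h

theorem T0Quotient.exists_isOpen (V : Set X) (hV : IsOpen V)
    (hR : ∀ a b, R a b → (a ∈ V ↔ b ∈ V)) :
    ∃ U : Set (T0Quotient R), IsOpen U ∧ Quotient.mk _ ⁻¹' U = V := by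
  have h : Quotient.mk (t0Setoid R) ⁻¹' (Quotient.mk (t0Setoid R) '' V) = V := by
    refine (subset_preimage_image _ V).antisymm' ?_
    rintro a ⟨b, hb, hab⟩
    exact (Quotient.exact hab V hV hR).1 hb
  exact ⟨_, isQuotientMap_quotient_mk'.isCoinducing.isOpen_preimage.1 (h.symm ▸ hV), h⟩

instance : T0Space (T0Quotient R) where
  t0 := by
    rintro ⟨x⟩ ⟨y⟩ h
    refine Quotient.sound fun V hV hR ↦ ?_
    obtain ⟨U, hU, rfl⟩ := T0Quotient.exists_isOpen V hV hR
    exact inseparable_iff_forall_isOpen.1 h U hU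

theorem T0Quotient.lift_sound [T0Space Y] {f : X → Y} (hf : Continuous f)
    (hR : ∀ a b, R a b → f a = f b) (x y : X) (h : t0Setoid R x y) : f x = f y :=
  (inseparable_iff_forall_isOpen.2 fun U hU ↦ h (f ⁻¹' U) (hU.preimage hf) fun a b hab ↦ by
    simp [hR a b hab]).eq

theorem IsRepresentable.t0Quotient {Γ : PointclassFamily.{0}} [ProjectivelyClosed Γ]
    [IsGeneratedBy ConvSeq X] (hX : IsRepresentable Γ X)
    (hR : Definable Γ {r : X × X | R r.1 r.2}) : IsRepresentable Γ (T0Quotient R) :=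
  hX.quotient isQuotientMap_quotient_mk' hR (fun _ _ ↦ T0Quotient.sound) T0Quotient.exists_isOpen

end T0Quotient

/-! ### Limits and colimits of qcb₀-spaces -/

namespace QCB0

instance (X : QCB0.{u}) : T0Space X.obj := X.property.t0Space

instance (X : QCB0.{u}) : IsGeneratedBy ConvSeq X.obj := X.property.isGeneratedBy

/-- The underlying continuous function of a morphism. -/
abbrev toMap {X Y : QCB0.{u}} (f : X ⟶ Y) : C(X.obj, Y.obj) := f.hom.hom

/-- The morphism that is given by a continuous function. -/
abbrev ofMap {X Y : QCB0.{u}} (f : C(X.obj, Y.obj)) : X ⟶ Y :=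
  ObjectProperty.homMk (TopCat.ofHom f)

theorem hom_ext {X Y : QCB0.{u}} {f g : X ⟶ Y} (h : ∀ x, toMap f x = toMap g x) : f = g :=
  ObjectProperty.hom_ext _ (TopCat.hom_ext (ContinuousMap.ext h))

/-- The object that is given by a representable space. -/
abbrev ofRepresentable (X : Type u) [TopologicalSpace X] [T0Space X] [IsGeneratedBy ConvSeq X]
    {Γ : PointclassFamily.{0}} (h : IsRepresentable Γ X) : QCB0.{u} :=
  ⟨TopCat.of X, h.isQCB0⟩

theorem isRepresentable_of_iso {Γ : PointclassFamily.{0}} {X Y : QCB0.{u}} (e : X ≅ Y)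
    (h : IsRepresentable Γ X.obj) : IsRepresentable Γ Y.obj :=
  h.of_homeomorph (TopCat.homeoOfIso ((ObjectProperty.ι _).mapIso e))

variable {J : Type} [SmallCategory J]

section Limits

variable (F : J ⥤ QCB0.{u})

/-- The compatible families of a diagram of qcb₀-spaces, as a subspace of the product. -/
abbrev Sections : Type u :=
  {x : ∀ j, (F.obj j).obj // ∀ (j k : J) (f : j ⟶ k), toMap (F.map f) (x j) = x k}

theorem isRepresentable_sections [CountableCategory J] {Γ : PointclassFamily.{0}}
    [ProjectivelyClosed Γ] (hF : ∀ j, IsRepresentable Γ (F.obj j).obj) :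
    IsRepresentable Γ (Sections F) := by
  refine (IsRepresentable.pi hF).subtype ?_
  simp only [ofPred_forall]
  exact .iInter fun j ↦ .iInter fun k ↦ .iInter fun f ↦ (hF k).definable_eq
    (Continuous.continuousGeneratedBy (by fun_prop))
    (Continuous.continuousGeneratedBy (by fun_prop))

variable [CountableCategory J]

/-- The limit cone of a countable diagram of qcb₀-spaces. -/
noncomputable def limitCone : Cone F where
  pt := ofRepresentable (Seq (Sections F))
    (isRepresentable_sections F fun j ↦ (F.obj j).property.isRepresentable).toSeq
  π :=
    { app j := ofMap ⟨fun x ↦ (WithGeneratedByTopology.equiv x : Sections F).1 j,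
        ((continuous_apply j).comp continuous_subtype_val).comp continuous_fromSeq⟩
      naturality j k f := hom_ext fun x ↦
        ((WithGeneratedByTopology.equiv x : Sections F).2 j k f).symm }

/-- The morphism into the limit that is induced by a cone. -/
noncomputable def limitLift (s : Cone F) : s.pt ⟶ (limitCone F).pt :=
  let φ (j : J) : C(s.pt.obj, (F.obj j).obj) := toMap (s.π.app j)
  have hc : Continuous fun w j ↦ φ j w := continuous_pi fun j ↦ (φ j).continuous
  let ψ (w : s.pt.obj) : Sections F :=
    ⟨fun j ↦ φ j w, fun _ _ f ↦ congrArg (fun g ↦ toMap g w) (s.w f)⟩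
  have hψ : Continuous ψ := hc.subtype_mk _
  ofMap ⟨fun w ↦ (WithGeneratedByTopology.equiv (X := ConvSeq) (Y := Sections F)).symm (ψ w),
    (scont_toSeq.comp hψ.continuousGeneratedBy).continuous⟩

/-- The limit cone is universal. -/
noncomputable def isLimitLimitCone : IsLimit (limitCone F) where
  lift := limitLift F
  fac s j := rfl
  uniq s m hm := hom_ext fun w ↦ by
    refine (WithGeneratedByTopology.equiv (X := ConvSeq) (Y := Sections F)).injective
      (Subtype.ext (funext fun j ↦ ?_))
    exact congrArg (fun g ↦ toMap g w) (hm j)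

end Limits

section Colimits

variable (F : J ⥤ QCB0.{u})

/-- The relation on the sum of a diagram of qcb₀-spaces that is generated by the morphisms. -/
def colimitRel (a b : Σ j, (F.obj j).obj) : Prop :=
  ∃ (j k : J) (f : j ⟶ k) (x : (F.obj j).obj), ⟨j, x⟩ = a ∧ ⟨k, toMap (F.map f) x⟩ = b

variable [CountableCategory J]

/-- The generating relation is a countable union, over morphisms, of relations with one quantifier
over points. The equivalence relation it induces on the sum is never estimated. -/
theorem isRepresentable_colimit {Γ : PointclassFamily.{0}}
    [ProjectivelyClosed Γ] (hF : ∀ j, IsRepresentable Γ (F.obj j).obj) :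
    IsRepresentable Γ (T0Quotient (colimitRel F)) := by
  have hS := IsRepresentable.sigma hF
  refine hS.t0Quotient ?_
  simp only [colimitRel, ofPred_exists]
  refine .iUnion fun j ↦ .iUnion fun k ↦ .iUnion fun f ↦ ?_
  rw [← ofPred_exists]
  refine Definable.exists (A := {r : (F.obj j).obj × ((Σ j, (F.obj j).obj) × Σ j, (F.obj j).obj) |
    ⟨j, r.1⟩ = r.2.1 ∧ ⟨k, toMap (F.map f) r.1⟩ = r.2.2}) (hF j) (.inter ?_ ?_)
  · have h : Continuous fun r : (F.obj j).obj × ((Σ j, (F.obj j).obj) × Σ j, (F.obj j).obj) ↦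
        (⟨j, r.1⟩ : Σ j, (F.obj j).obj) :=
      (continuous_sigmaMk (σ := fun j ↦ (F.obj j).obj)).comp continuous_fst
    exact hS.definable_eq h.continuousGeneratedBy
      (continuous_fst.comp continuous_snd).continuousGeneratedBy
  · have h : Continuous fun r : (F.obj j).obj × ((Σ j, (F.obj j).obj) × Σ j, (F.obj j).obj) ↦
        (⟨k, toMap (F.map f) r.1⟩ : Σ j, (F.obj j).obj) :=
      (continuous_sigmaMk (σ := fun j ↦ (F.obj j).obj)).comp
        ((toMap (F.map f)).continuous.comp continuous_fst)
    exact hS.definable_eq h.continuousGeneratedBy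
      (continuous_snd.comp continuous_snd).continuousGeneratedBy

/-- The colimit cocone of a countable diagram of qcb₀-spaces. -/
noncomputable def colimitCocone : Cocone F where
  pt := ofRepresentable (T0Quotient (colimitRel F))
    (isRepresentable_colimit F fun j ↦ (F.obj j).property.isRepresentable)
  ι :=
    { app j := ofMap ⟨fun x ↦ Quotient.mk _ ⟨j, x⟩, continuous_quotient_mk'.comp continuous_sigmaMk⟩
      naturality j k f := hom_ext fun x ↦ (T0Quotient.sound ⟨j, k, f, x, rfl, rfl⟩).symm }

/-- The colimit cocone is universal. -/
noncomputable def isColimitColimitCocone : IsColimit (colimitCocone F) where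
  desc s := by
    let φ (j : J) : C((F.obj j).obj, s.pt.obj) := toMap (s.ι.app j)
    have hc : Continuous fun a : Σ j, (F.obj j).obj ↦ φ a.1 a.2 :=
      continuous_sigma fun j ↦ (φ j).continuous
    refine ofMap ⟨Quotient.lift (fun a ↦ φ a.1 a.2) (T0Quotient.lift_sound hc ?_),
      hc.quotient_lift _⟩
    rintro _ _ ⟨j, k, f, x, rfl, rfl⟩
    exact (congrArg (fun g ↦ toMap g x) (s.w f)).symm
  fac s j := rfl
  uniq s m hm := hom_ext fun a ↦ by
    obtain ⟨⟨j, x⟩, rfl⟩ := Quotient.exists_rep a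
    exact congrArg (fun g ↦ toMap g x) (hm j)

end Colimits

variable [CountableCategory J]

instance : HasLimitsOfShape J QCB0.{u} := ⟨fun F ↦ ⟨⟨⟨_, isLimitLimitCone F⟩⟩⟩⟩

instance : HasColimitsOfShape J QCB0.{u} := ⟨fun F ↦ ⟨⟨⟨_, isColimitColimitCocone F⟩⟩⟩⟩

instance : (hyperprojective.{u}).IsClosedUnderLimitsOfShape J where
  limitsOfShape_le := by
    rintro X ⟨p⟩
    -- Any limit is isomorphic to the one constructed above, which is now bounded with
    -- `hyperprojectiveSets` in place of `allSets`.
    refine hyperprojective_iff.2 (isRepresentable_of_iso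
      ((isLimitLimitCone p.diag).conePointUniqueUpToIso p.isLimit) ?_)
    exact (isRepresentable_sections _ fun j ↦ hyperprojective_iff.1 (p.prop_diag_obj j)).toSeq

instance : (hyperprojective.{u}).IsClosedUnderColimitsOfShape J where
  colimitsOfShape_le := by
    rintro X ⟨p⟩
    refine hyperprojective_iff.2 (isRepresentable_of_iso
      ((isColimitColimitCocone p.diag).coconePointUniqueUpToIso p.isColimit) ?_)
    exact isRepresentable_colimit _ fun j ↦ hyperprojective_iff.1 (p.prop_diag_obj j)

end QCB0

/-! ### Exponentials in full subcategories -/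

section FullSubcategory

open MonoidalCategory

variable {C : Type u} [Category.{v} C] [CartesianMonoidalCategory C] [MonoidalClosed C]
  (P : ObjectProperty C) [P.IsClosedUnderLimitsOfShape (Discrete PEmpty)]
  [P.IsClosedUnderLimitsOfShape (Discrete WalkingPair)]

/-- A full subcategory that is closed under finite products and exponentials is cartesian
closed. -/
@[reducible]
def fullSubcategoryMonoidalClosed (hP : ∀ X Y : C, P X → P Y → P ((ihom X).obj Y)) :
    MonoidalClosed P.FullSubcategory where
  closed X :=
    { rightAdj := P.lift (P.ι ⋙ ihom X.1) fun Y ↦ hP _ _ X.2 Y.2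
      adj :=
        { unit :=
            { app Y := ObjectProperty.homMk ((ihom.coev X.1).app Y.1)
              naturality _ _ f := ObjectProperty.hom_ext _ ((ihom.coev X.1).naturality f.hom) }
          counit :=
            { app Y := ObjectProperty.homMk ((ihom.ev X.1).app Y.1)
              naturality _ _ f := ObjectProperty.hom_ext _ ((ihom.ev X.1).naturality f.hom) }
          left_triangle_components Y :=
            ObjectProperty.hom_ext _ ((ihom.adjunction X.1).left_triangle_components Y.1)
          right_triangle_components Y :=
            ObjectProperty.hom_ext _ ((ihom.adjunction X.1).right_triangle_components Y.1) } }

/-- Exponentials and evaluations of the subcategory are those of `C`, so each component of the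
comparison is an identity. -/
theorem monoidalClosedFunctor_ι (hP : ∀ X Y : C, P X → P Y → P ((ihom X).obj Y))
    [PreservesLimitsOfShape (Discrete WalkingPair) P.ι] :
    letI := fullSubcategoryMonoidalClosed P hP
    MonoidalClosedFunctor P.ι := by
  let _ := fullSubcategoryMonoidalClosed P hP
  refine ⟨fun A ↦ ?_⟩
  have h : ∀ B, IsIso ((expComparison P.ι A).natTrans.app B) := fun B ↦ by
    have : (expComparison P.ι A).natTrans.app B = 𝟙 ((ihom A.obj).obj B.obj) := by
      apply MonoidalClosed.uncurry_injective
      rw [uncurry_expComparison]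
      have h : CartesianMonoidalCategory.prodComparison P.ι A ((ihom A).obj B) =
          𝟙 (A.obj ⊗ ((ihom A).obj B).obj) :=
        CartesianMonoidalCategory.hom_ext _ _
          ((CartesianMonoidalCategory.prodComparison_fst ..).trans (Category.id_comp _).symm)
          ((CartesianMonoidalCategory.prodComparison_snd ..).trans (Category.id_comp _).symm)
      rw [IsIso.inv_comp_eq, h]
      exact ((Category.id_comp _).trans (MonoidalClosed.uncurry_id_eq_ev A.obj B.obj)).symm
    rw [this]
    exact IsIso.id _
  exact NatIso.isIso_of_isIso_app _

end FullSubcategory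

/-! ### Exponentials of qcb₀-spaces -/

namespace QCB0

open MonoidalCategory

/-- The terminal qcb₀-space. -/
noncomputable def terminalCone : LimitCone (Functor.empty.{0} QCB0.{u}) where
  cone := asEmptyCone (ofRepresentable PUnit.{u + 1}
    (isRepresentable_of_secondCountable (X := PUnit.{u + 1})))
  isLimit := IsTerminal.ofUniqueHom (fun _ ↦ ofMap ⟨fun _ ↦ PUnit.unit, continuous_const⟩)
    fun _ _ ↦ hom_ext fun _ ↦ rfl

/-- The binary product of qcb₀-spaces. -/
noncomputable def prodObj (X Y : QCB0.{u}) : QCB0.{u} :=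
  ofRepresentable (Seq (X.obj × Y.obj))
    (X.property.isRepresentable.prod Y.property.isRepresentable).toSeq

/-- The binary product cone of qcb₀-spaces. -/
noncomputable def prodCone (X Y : QCB0.{u}) : LimitCone (pair X Y) where
  cone := BinaryFan.mk (P := prodObj X Y)
    (ofMap ⟨fun r ↦ (WithGeneratedByTopology.equiv (X := ConvSeq) (Y := X.obj × Y.obj) r).1,
      continuous_fst.comp continuous_fromSeq⟩)
    (ofMap ⟨fun r ↦ (WithGeneratedByTopology.equiv (X := ConvSeq) (Y := X.obj × Y.obj) r).2,
      continuous_snd.comp continuous_fromSeq⟩)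
  isLimit := BinaryFan.IsLimit.mk _
    (fun {T} f g ↦ ofMap (X := T) (Y := prodObj X Y)
      ⟨fun t ↦ (WithGeneratedByTopology.equiv (X := ConvSeq) (Y := X.obj × Y.obj)).symm
        (toMap f t, toMap g t), (scont_toSeq.comp ((toMap f).continuous.prodMk
          (toMap g).continuous).continuousGeneratedBy).continuous⟩)
    (fun _ _ ↦ rfl) (fun _ _ ↦ rfl)
    fun _ _ _ hf hg ↦ hom_ext fun t ↦
      (WithGeneratedByTopology.equiv (X := ConvSeq) (Y := X.obj × Y.obj)).injective
        (Prod.ext (congrArg (fun h ↦ toMap h t) hf) (congrArg (fun h ↦ toMap h t) hg))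

noncomputable instance : CartesianMonoidalCategory QCB0.{u} :=
  .ofChosenFiniteProducts terminalCone prodCone

/-- The exponential of qcb₀-spaces. -/
noncomputable def expObj (X Y : QCB0.{u}) : QCB0.{u} :=
  ofRepresentable (Seq (SMap X.obj Y.obj))
    (X.property.isRepresentable.functionSpace Y.property.isRepresentable).toSeq

/-- Currying of morphisms of qcb₀-spaces. -/
noncomputable def curry {X W Y : QCB0.{u}} (f : prodObj X W ⟶ Y) : W ⟶ expObj X Y :=
  let φ : C(Seq (X.obj × W.obj), Y.obj) := toMap f
  let F : SMap (X.obj × W.obj) Y.obj :=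
    ⟨fun r ↦ φ ((WithGeneratedByTopology.equiv (X := ConvSeq) (Y := X.obj × W.obj)).symm r),
      φ.continuous.continuousGeneratedBy.comp scont_toSeq⟩
  ofMap ⟨fun w ↦ (WithGeneratedByTopology.equiv (X := ConvSeq) (Y := SMap X.obj Y.obj)).symm
      (ContinuousMapGeneratedBy.curryEquiv F w),
    (scont_toSeq.comp (ContinuousMapGeneratedBy.curryEquiv F).prop).continuous⟩

/-- Uncurrying of morphisms of qcb₀-spaces. -/
noncomputable def uncurry {X W Y : QCB0.{u}} (g : W ⟶ expObj X Y) : prodObj X W ⟶ Y :=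
  let γ : C(W.obj, Seq (SMap X.obj Y.obj)) := toMap g
  let G : SMap W.obj (SMap X.obj Y.obj) :=
    ⟨fun w ↦ WithGeneratedByTopology.equiv (X := ConvSeq) (Y := SMap X.obj Y.obj) (γ w),
      (continuous_fromSeq.comp γ.continuous).continuousGeneratedBy⟩
  ofMap ⟨fun r ↦ ContinuousMapGeneratedBy.curryEquiv.symm G
      (WithGeneratedByTopology.equiv (X := ConvSeq) (Y := X.obj × W.obj) r),
    ((ContinuousMapGeneratedBy.curryEquiv.symm G).prop.comp
      continuous_fromSeq.continuousGeneratedBy).continuous⟩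

/-- Currying as a bijection. -/
noncomputable def expEquiv (X W Y : QCB0.{u}) : (X ⊗ W ⟶ Y) ≃ (W ⟶ expObj X Y) where
  toFun f := curry (X := X) (W := W) f
  invFun g := uncurry g
  left_inv _ := rfl
  right_inv _ := rfl

noncomputable instance : MonoidalClosed QCB0.{u} where
  closed X :=
    { rightAdj := _
      adj := Adjunction.adjunctionOfEquivRight (G_obj := expObj X) (expEquiv X)
        fun _ _ _ _ _ ↦ rfl }

theorem hyperprojective_ihom (X Y : QCB0.{u}) (hX : hyperprojective X) (hY : hyperprojective Y) :
    hyperprojective ((ihom X).obj Y) :=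
  (hyperprojective_iff (X := expObj X Y)).2
    ((hyperprojective_iff.1 hX).functionSpace (hyperprojective_iff.1 hY)).toSeq

end QCB0

end Hyperprojective

theorem theorem7p1 :
    -- the ambient category is countably complete and countably co-complete
    (HasCountableLimits QCB0.{u} ∧ HasCountableColimits QCB0.{u}) ∧
    -- so is the category of hyperprojective spaces
    (HasCountableLimits QCB0HP.{u} ∧ HasCountableColimits QCB0HP.{u}) ∧
    -- both categories are cartesian closed, and exponentials are inherited:
    -- exponentials in QCB0 of hyperprojective spaces are hyperprojective, and the inclusion
    -- preserves products and exponentials (with their evaluation morphisms)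
    (∃ (_ : CartesianMonoidalCategory QCB0.{u}) (_ : MonoidalClosed QCB0.{u})
        (_ : CartesianMonoidalCategory QCB0HP.{u}) (_ : MonoidalClosed QCB0HP.{u})
        (_ : PreservesLimitsOfShape (Discrete WalkingPair) incl.{u}),
        (∀ X Y : QCB0.{u}, hyperprojective X → hyperprojective Y →
          hyperprojective ((ihom X).obj Y)) ∧
        MonoidalClosedFunctor incl.{u}) ∧
    -- countable products and co-products are inherited
    (∀ (J : Type) [Countable J],
      (hyperprojective.{u}).IsClosedUnderLimitsOfShape (Discrete J) ∧
      PreservesLimitsOfShape (Discrete J) incl.{u} ∧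
      (hyperprojective.{u}).IsClosedUnderColimitsOfShape (Discrete J) ∧
      PreservesColimitsOfShape (Discrete J) incl.{u}) ∧
    -- equalizers are inherited
    ((hyperprojective.{u}).IsClosedUnderLimitsOfShape WalkingParallelPair ∧
      PreservesLimitsOfShape WalkingParallelPair incl.{u}) ∧
    -- co-equalizers are inherited
    ((hyperprojective.{u}).IsClosedUnderColimitsOfShape WalkingParallelPair ∧
      PreservesColimitsOfShape WalkingParallelPair incl.{u}) := by
  have h (J : Type) [SmallCategory J] [CountableCategory J] :
      PreservesLimitsOfShape J incl.{u} ∧ PreservesColimitsOfShape J incl.{u} :=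
    ⟨inferInstance, inferInstance⟩
  refine ⟨⟨⟨fun J _ _ ↦ inferInstance⟩, ⟨fun J _ _ ↦ inferInstance⟩⟩,
    ⟨⟨fun J _ _ ↦ inferInstance⟩, ⟨fun J _ _ ↦ inferInstance⟩⟩,
    ⟨inferInstance, inferInstance, inferInstance,
      fullSubcategoryMonoidalClosed _ QCB0.hyperprojective_ihom, (h _).1,
      QCB0.hyperprojective_ihom, ?_⟩,
    fun J _ ↦ ⟨inferInstance, (h _).1, inferInstance, (h _).2⟩,
    ⟨inferInstance, (h _).1⟩, ⟨inferInstance, (h _).2⟩⟩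
  have := (h (Discrete WalkingPair)).1
  exact monoidalClosedFunctor_ι _ QCB0.hyperprojective_ihom
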